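/- A \emph{brace} means a skew left brace: a set $B$ with two group structures $(B,+)$ and $(B,\cdot)$ (neither assumed commutative) such that $a(b+c)=ab-a+ac$ for all $a,b,c\in B$. Put $\lambda_a(b)=-a+ab$. An \emph{ideal} of $B$ is a subset that is a normal subgroup of both $(B,+)$ and $(B,\cdot)$ and is invariant under every $\lambda_b$, $b\in B$; and $\operatorname{Soc}(B)=\{a\in B:\lambda_a=\mathrm{id}\}\cap Z(B,+)$. A brace $B$ is \emph{almost polycyclic} if it has a finite chain of ideals $\{0\}=J_0\leq J_1\leq\dots\leq J_n=B$ such that, for all $0\leq i<n$, either $J_{i+1}/J_i\leq\operatorname{Soc}(B/J_i)$ and $J_{i+1}/J_i$ is finitely generated, or $J_{i+1}/J_i$ is finite. A brace $B$ is \emph{supersoluble} if it has a finite chain of ideals $\{0\}=I_0\leq I_1\leq\dots\leq I_n=B$ such that, for all $0\leq i<n$, either $(I_{i+1}/I_i,+)$ is infinite cyclic and $I_{i+1}/I_i\leq\operatorname{Soc}(B/I_i)$, or $I_{i+1}/I_i$ has prime order. \textbf{Theorem.} Let $B$ be an almost polycyclic brace. Then $B$ is supersoluble if and only if all its finite homomorphic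 images are supersoluble. -/

import Mathlib

universe u

/-- A skew left brace: a set with two group structures `(B, +)` (not necessarily commutative)
and `(B, *)` such that `a * (b + c) = a * b - a + a * c`. -/
class SkewBrace (B : Type*) extends AddGroup B, Group B where
  mul_add_eq (a b c : B) : a * (b + c) = a * b - a + a * c

namespace SkewBrace

section Basic

variable {B : Type*} [SkewBrace B]

/-- The map `λ_a : b ↦ -a + a * b`. -/
def lam (a b : B) : B := -a + a * b

/-- The two identity elements coincide. -/
theorem one_eq_zero : (1 : B) = 0 := by
  have h := mul_add_eq (1 : B) 0 0
  simp only [one_mul, add_zero, zero_sub] at h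
  exact (neg_eq_zero.mp h.symm)

theorem mul_zero_eq (a : B) : a * 0 = a := by
  rw [← one_eq_zero, mul_one]

theorem lam_inv_neg_add (a b : B) : lam a⁻¹ (-a + b) = a⁻¹ * b := by
  have h := mul_add_eq a⁻¹ a (-a)
  rw [add_neg_cancel, mul_zero_eq, inv_mul_cancel, one_eq_zero, zero_sub] at h
  have h2 : a⁻¹ * (-a) = a⁻¹ + a⁻¹ := neg_add_eq_iff_eq_add.mp h.symm
  rw [lam, mul_add_eq, h2, add_sub_cancel_right, neg_add_cancel_left]

theorem lam_inv_mul (a b : B) : lam a (a⁻¹ * b) = -a + b := by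
  rw [lam, mul_inv_cancel_left]

end Basic

/-- A subbrace: a subset that is a subgroup of both `(B, +)` and `(B, *)`. -/
structure Subbrace (B : Type*) [SkewBrace B] extends AddSubgroup B where
  mul_mem' {a b : B} : a ∈ carrier → b ∈ carrier → a * b ∈ carrier
  inv_mem' {a : B} : a ∈ carrier → a⁻¹ ∈ carrier

instance (B : Type*) [SkewBrace B] : SetLike (Subbrace B) B where
  coe S := S.carrier
  coe_injective S T h := by
    obtain ⟨S, _, _⟩ := S
    obtain ⟨T, _, _⟩ := T
    have : S = T := SetLike.coe_injective h
    subst this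
    rfl

/-- A subbrace is finitely generated (as a brace) if it is the smallest subbrace containing
some finite set. -/
def Subbrace.FG {B : Type*} [SkewBrace B] (S : Subbrace B) : Prop :=
  ∃ E : Finset B, (E : Set B) ⊆ S ∧ ∀ T : Subbrace B, (E : Set B) ⊆ T → (S : Set B) ⊆ T

/-- An ideal: a subbrace invariant under all maps `λ_b`, normal in `(B, +)` and in `(B, *)`. -/
structure Ideal (B : Type*) [SkewBrace B] extends Subbrace B where
  lam_mem' (b : B) {a : B} : a ∈ carrier → lam b a ∈ carrier
  add_conj_mem' (b : B) {a : B} : a ∈ carrier → b + a + -b ∈ carrier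
  mul_conj_mem' (b : B) {a : B} : a ∈ carrier → b * a * b⁻¹ ∈ carrier

instance (B : Type*) [SkewBrace B] : SetLike (Ideal B) B where
  coe S := S.carrier
  coe_injective S T h := by
    obtain ⟨S, _, _, _⟩ := S
    obtain ⟨T, _, _, _⟩ := T
    have : S = T := SetLike.coe_injective h
    subst this
    rfl

section Quotient

variable {B : Type*} [SkewBrace B] (I : Ideal B)

instance Ideal.normal_toAddSubgroup : I.toAddSubgroup.Normal where
  conj_mem _ ha b := I.add_conj_mem' b ha

/-- The additive and multiplicative left cosets of an ideal coincide. -/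
theorem Ideal.inv_mul_mem_iff (a b : B) :
    a⁻¹ * b ∈ I.toAddSubgroup ↔ -a + b ∈ I.toAddSubgroup := by
  constructor
  · intro h
    rw [← lam_inv_mul]
    exact I.lam_mem' a h
  · intro h
    rw [← lam_inv_neg_add]
    exact I.lam_mem' a⁻¹ h

theorem Ideal.mul_rel {a a' b b' : B} (ha : -a + a' ∈ I.toAddSubgroup)
    (hb : -b + b' ∈ I.toAddSubgroup) : -(a * b) + a' * b' ∈ I.toAddSubgroup := by
  rw [← I.inv_mul_mem_iff] at ha hb ⊢
  have h1 := I.mul_conj_mem' b⁻¹ ha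
  have h2 := I.mul_mem' h1 hb
  have h3 : b⁻¹ * (a⁻¹ * a') * b⁻¹⁻¹ * (b⁻¹ * b') = (a * b)⁻¹ * (a' * b') := by group
  rw [h3] at h2
  exact h2

theorem Ideal.inv_rel {a a' : B} (ha : -a + a' ∈ I.toAddSubgroup) :
    -a⁻¹ + a'⁻¹ ∈ I.toAddSubgroup := by
  rw [← I.inv_mul_mem_iff] at ha ⊢
  have h1 := I.mul_conj_mem' a (I.inv_mem' ha)
  have h3 : a * (a⁻¹ * a')⁻¹ * a⁻¹ = a⁻¹⁻¹ * a'⁻¹ := by group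
  rw [h3] at h1
  exact h1

/-- The underlying type of the quotient `B / I`: the cosets of `I`. -/
abbrev Ideal.Quot : Type _ := B ⧸ I.toAddSubgroup

/-- The quotient map `B → B / I`. -/
abbrev Ideal.toQuot (b : B) : I.Quot := QuotientAddGroup.mk b

instance : Mul I.Quot where
  mul := _root_.Quotient.map₂ (· * ·) fun _ _ ha _ _ hb =>
    QuotientAddGroup.leftRel_apply.mpr
      (I.mul_rel (QuotientAddGroup.leftRel_apply.mp ha) (QuotientAddGroup.leftRel_apply.mp hb))

instance : One I.Quot where
  one := I.toQuot 1

instance : Inv I.Quot where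
  inv := _root_.Quotient.map (·⁻¹) fun _ _ ha =>
    QuotientAddGroup.leftRel_apply.mpr (I.inv_rel (QuotientAddGroup.leftRel_apply.mp ha))

theorem Ideal.toQuot_mul (a b : B) : I.toQuot (a * b) = I.toQuot a * I.toQuot b := rfl

theorem Ideal.toQuot_inv (a : B) : I.toQuot a⁻¹ = (I.toQuot a)⁻¹ := rfl

theorem Ideal.toQuot_add (a b : B) : I.toQuot (a + b) = I.toQuot a + I.toQuot b := rfl

theorem Ideal.toQuot_sub (a b : B) : I.toQuot (a - b) = I.toQuot a - I.toQuot b := rfl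

/-- The multiplicative group of `B / I`, with `(aI)(bI) = (ab)I`. -/
instance : Group I.Quot :=
  Group.ofLeftAxioms
    (by
      rintro ⟨a⟩ ⟨b⟩ ⟨c⟩
      exact congrArg I.toQuot (mul_assoc a b c))
    (by
      rintro ⟨a⟩
      exact congrArg I.toQuot (one_mul a))
    (by
      rintro ⟨a⟩
      exact congrArg I.toQuot (inv_mul_cancel a))

/-- The quotient brace `B / I`. -/
instance : SkewBrace I.Quot where
  mul_add_eq := by
    rintro ⟨a⟩ ⟨b⟩ ⟨c⟩
    exact congrArg I.toQuot (mul_add_eq a b c)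

/-- For ideals `I` and `J` (with `I ⊆ J` in all uses), the factor `J / I` as a subbrace of `B / I`:
the image of `J` under the quotient map. -/
def Ideal.factor (J : Ideal B) : Subbrace I.Quot where
  toAddSubgroup := J.toAddSubgroup.map (QuotientAddGroup.mk' I.toAddSubgroup)
  mul_mem' := by
    rintro _ _ ⟨a, ha, rfl⟩ ⟨b, hb, rfl⟩
    exact ⟨a * b, J.mul_mem' ha hb, rfl⟩
  inv_mem' := by
    rintro _ ⟨a, ha, rfl⟩
    exact ⟨a⁻¹, J.inv_mem' ha, rfl⟩

end Quotient

/-- The socle `Soc(B) = Ker λ ∩ Z(B, +)`. -/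
def socle (B : Type*) [SkewBrace B] : Set B :=
  {a | (∀ b : B, lam a b = b) ∧ a ∈ AddSubgroup.center B}

/-- `B` is almost polycyclic: there is a finite chain of ideals `{0} = J₀ ≤ J₁ ≤ … ≤ Jₙ = B` such
that each factor `Jᵢ₊₁ / Jᵢ` is either finitely generated and contained in `Soc(B / Jᵢ)`,
or finite. -/
def IsAlmostPolycyclic (B : Type*) [SkewBrace B] : Prop :=
  ∃ (n : ℕ) (J : ℕ → Ideal B), (J 0 : Set B) = {0} ∧ (J n : Set B) = Set.univ ∧
    ∀ i < n, (J i : Set B) ⊆ J (i + 1) ∧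
      ((((J i).factor (J (i + 1)) : Set (J i).Quot) ⊆ socle (J i).Quot ∧
          ((J i).factor (J (i + 1))).FG) ∨
        Finite ((J i).factor (J (i + 1))))

/-- `B` is supersoluble: there is a finite chain of ideals `{0} = I₀ ≤ I₁ ≤ … ≤ Iₙ = B` such
that for each factor `Iᵢ₊₁ / Iᵢ` either its additive group is infinite cyclic and it is contained
in `Soc(B / Iᵢ)`, or it has prime order. -/
def IsSupersoluble (B : Type*) [SkewBrace B] : Prop :=
  ∃ (n : ℕ) (I : ℕ → Ideal B), (I 0 : Set B) = {0} ∧ (I n : Set B) = Set.univ ∧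
    ∀ i < n, (I i : Set B) ⊆ I (i + 1) ∧
      ((Infinite ((I i).factor (I (i + 1))).toAddSubgroup ∧
          IsAddCyclic ((I i).factor (I (i + 1))).toAddSubgroup ∧
          ((I i).factor (I (i + 1)) : Set (I i).Quot) ⊆ socle (I i).Quot) ∨
        (Nat.card ((I i).factor (I (i + 1)))).Prime)

/-- A homomorphism of braces: a map preserving sums and products. -/
structure BraceHom (B C : Type*) [SkewBrace B] [SkewBrace C] where
  toFun : B → C
  map_add' (a b : B) : toFun (a + b) = toFun a + toFun b
  map_mul' (a b : B) : toFun (a * b) = toFun a * toFun b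

end SkewBrace

/-
A homomorphic image of a supersoluble brace is supersoluble because the image of a cyclic factor
is cyclic, and a finite cyclic factor in the socle refines to factors of prime order.

For the converse, the ideals of an almost polycyclic brace satisfy the ascending chain condition,
so one may assume that `B` is infinite and that all its proper quotients are supersoluble. Such a
`B` has an infinite socle: if `Soc(B)` and an ideal `I` were finite and `J / I ≤ Soc(B / I)`, then
for `a ∈ J` the map `λ_a` and conjugation by `a` would take finitely many values on a finite
generating set, and they determine `a` modulo `Soc(B)`, so `J` would be finite. Choose in the
socle a torsion-free `λ`-invariant subgroup `A` that is irreducible over `ℚ`. Every `B / pA` is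
supersoluble, so every `λ_b` is triangular on `A / pA`. Hence the `λ_b` commute, and the minimal
polynomial of each `λ_b` over `ℤ` is irreducible and splits modulo every prime. Such a polynomial
is linear: otherwise almost every prime `p` is the norm of two distinct prime ideals of a number
field, and products of these give more ideals of norm at most `X` than the bound `O(X)` allows, as
`∑ 1 / p` diverges. So `B` acts on `A` by scalars, and any nonzero element of `A` generates an
infinite cyclic ideal contained in the socle.
-/

section PrimeIdeals

open Polynomial NumberField Ideal Module RingOfIntegers Filter

section Dedekind

variable {S : Type*} [CommRing S] [IsDedekindDomain S] [Module.Free ℤ S]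

theorem eq_of_dvd_of_prime_absNorm {I J : Ideal S} (hI : (absNorm I).Prime)
    (hJ : (absNorm J).Prime) (h : I ∣ J) : I = J :=
  associated_iff_eq.mp <|
    ((irreducible_of_irreducible_absNorm hI).dvd_irreducible_iff_associated
      (irreducible_of_irreducible_absNorm hJ)).mp h

theorem absNorm_prod_map_primeFactorsList {P : ℕ → Ideal S} {k : ℕ}
    (hP : ∀ p ∈ k.primeFactorsList, absNorm (P p) = p) (hk : k ≠ 0) :
    absNorm (k.primeFactorsList.map P).prod = k := by
  rw [map_list_prod, List.map_map, List.map_congr_left (f := absNorm ∘ P) (g := id) hP, List.map_id,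
    Nat.prod_primeFactorsList hk]

theorem eq_of_prod_map_primeFactorsList_mul_eq {P Q : ℕ → Ideal S} {T : Set ℕ}
    (hT : ∀ p ∈ T, p.Prime) (hP : ∀ p ∈ T, absNorm (P p) = p) (hQ : ∀ p ∈ T, absNorm (Q p) = p)
    (hPQ : ∀ p ∈ T, P p ≠ Q p) {k l p q : ℕ} (hk : k ≠ 0) (hl : l ≠ 0)
    (hkT : ∀ r ∈ k.primeFactorsList, r ∈ T) (hlT : ∀ r ∈ l.primeFactorsList, r ∈ T)
    (hp : p ∈ T) (hq : q ∈ T)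
    (h : (k.primeFactorsList.map P).prod * Q p = (l.primeFactorsList.map P).prod * Q q) :
    k = l ∧ p = q := by
  have hPprime (r) (hr : r ∈ T) : (absNorm (P r)).Prime := (hP r hr).symm ▸ hT r hr
  have hQprime (r) (hr : r ∈ T) : (absNorm (Q r)).Prime := (hQ r hr).symm ▸ hT r hr
  have hQq : Prime (Q q) := (irreducible_of_irreducible_absNorm (hQprime q hq)).prime
  have hpq : p = q := by
    obtain hdvd | hdvd := hQq.dvd_or_dvd (h.symm ▸ dvd_mul_left _ _)
    · obtain ⟨_, hmem, hr⟩ := hQq.dvd_prod_iff.mp hdvd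
      obtain ⟨r, hrk, rfl⟩ := List.mem_map.mp hmem
      have hPr := hkT r hrk
      have heq := eq_of_dvd_of_prime_absNorm (hQprime q hq) (hPprime r hPr) hr
      obtain rfl : q = r := by rw [← hQ q hq, heq, hP r hPr]
      exact absurd heq.symm (hPQ q hq)
    · rw [← hQ p hp, ← hQ q hq, eq_of_dvd_of_prime_absNorm (hQprime q hq) (hQprime p hp) hdvd]
  subst hpq
  refine ⟨?_, rfl⟩
  rw [← absNorm_prod_map_primeFactorsList (fun r hr => hP r (hkT r hr)) hk,
    mul_right_cancel₀ hQq.ne_zero h,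
    absNorm_prod_map_primeFactorsList (fun r hr => hP r (hlT r hr)) hl]

end Dedekind

variable {K : Type*} [Field K] [NumberField K]

theorem exists_card_absNorm_le_le (K : Type*) [Field K] [NumberField K] :
    ∃ (C : ℝ) (X₀ : ℕ), ∀ X ≥ X₀, (Nat.card {I : Ideal (𝓞 K) // absNorm I ≤ X} : ℝ) ≤ C * X := by
  obtain ⟨C, hC⟩ := (NumberField.Ideal.tendsto_norm_le_div_atTop K).isBoundedUnder_le
  obtain ⟨X₀, hX₀⟩ := eventually_atTop.mp
    ((tendsto_natCast_atTop_atTop.eventually (eventually_map.mp hC)).and (eventually_gt_atTop 0))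
  refine ⟨C, X₀, fun X hX => ?_⟩
  obtain ⟨h, hpos⟩ := hX₀ X hX
  simpa only [Nat.cast_le] using (div_le_iff₀ (Nat.cast_pos.mpr hpos)).mp h

section Count

variable {P Q : ℕ → Ideal (𝓞 K)} {M : ℕ} {s : Finset ℕ}

theorem sum_div_le_card_absNorm_le (hM : M ≠ 0)
    (h : ∀ p : ℕ, p.Prime → p.Coprime M → absNorm (P p) = p ∧ absNorm (Q p) = p ∧ P p ≠ Q p)
    (hs : ∀ p ∈ s, p.Prime ∧ p.Coprime M) (N : ℕ) :
    ∑ p ∈ s, N / p ≤ Nat.card {I : Ideal (𝓞 K) // absNorm I ≤ N * M} := by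
  have hfactors (j : ℕ) : ∀ r ∈ (j * M + 1).primeFactorsList, r.Prime ∧ r.Coprime M := by
    intro r hr
    rw [Nat.mem_primeFactorsList (Nat.succ_ne_zero _)] at hr
    exact ⟨hr.1, Nat.Coprime.coprime_dvd_left hr.2 (by simp)⟩
  have hnorm (p : s) (j : Fin (N / p)) :
      absNorm (((j * M + 1).primeFactorsList.map P).prod * Q p) ≤ N * M := by
    obtain ⟨hp, hpM⟩ := hs p p.2
    rw [map_mul, (h p hp hpM).2.1, absNorm_prod_map_primeFactorsList
      (fun r hr => (h r (hfactors j r hr).1 (hfactors j r hr).2).1) (Nat.succ_ne_zero _)]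
    calc (j * M + 1) * (p : ℕ) ≤ (j * M + M) * p := by gcongr; exact Nat.pos_of_ne_zero hM
      _ = (j + 1) * p * M := by ring
      _ ≤ N * M := by gcongr; exact (Nat.le_div_iff_mul_le hp.pos).mp j.2
  -- `Q p` is the only factor of `F (p, j)` that is not a `P r`, and the remaining factors have norm
  -- `j * M + 1`, which is coprime to `M`; so `F (p, j)` determines `p` and `j`.
  let F (x : Σ p : s, Fin (N / p)) : {I : Ideal (𝓞 K) // absNorm I ≤ N * M} :=
    ⟨((x.2 * M + 1).primeFactorsList.map P).prod * Q x.1, hnorm x.1 x.2⟩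
  have hF : Function.Injective F := by
    rintro ⟨p, i⟩ ⟨q, j⟩ hij
    obtain ⟨hij, hpq⟩ := eq_of_prod_map_primeFactorsList_mul_eq
      (T := {p | p.Prime ∧ p.Coprime M}) (fun p hp => hp.1) (fun p hp => (h p hp.1 hp.2).1)
      (fun p hp => (h p hp.1 hp.2).2.1) (fun p hp => (h p hp.1 hp.2).2.2)
      (Nat.succ_ne_zero _) (Nat.succ_ne_zero _) (hfactors i) (hfactors j) (hs p p.2) (hs q q.2)
      (congrArg Subtype.val hij)
    obtain rfl := Subtype.ext hpq
    obtain rfl := Fin.ext (Nat.mul_right_cancel (Nat.pos_of_ne_zero hM) (Nat.succ_injective hij))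
    rfl
  have : Finite {I : Ideal (𝓞 K) // absNorm I ≤ N * M} := finite_setOfPred_absNorm_le (N * M)
  calc ∑ p ∈ s, N / p = Nat.card (Σ p : s, Fin (N / p)) := by
        simp [Finset.sum_attach s fun p => N / p]
    _ ≤ _ := Nat.card_le_card_of_injective F hF

theorem exists_sum_one_div_le (hM : M ≠ 0)
    (h : ∀ p : ℕ, p.Prime → p.Coprime M → absNorm (P p) = p ∧ absNorm (Q p) = p ∧ P p ≠ Q p) :
    ∃ C : ℝ, ∀ s : Finset ℕ, (∀ p ∈ s, p.Prime ∧ p.Coprime M) → ∑ p ∈ s, (1 / p : ℝ) ≤ C := by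
  obtain ⟨C, X₀, hC⟩ := exists_card_absNorm_le_le K
  refine ⟨C * M, fun s hs => ?_⟩
  set N : ℕ := (X₀ + 1) * ∏ p ∈ s, p
  have hprod : 0 < ∏ p ∈ s, p := Finset.prod_pos fun p hp => (hs p hp).1.pos
  have hN : 0 < N := Nat.mul_pos X₀.succ_pos hprod
  have hX₀ : X₀ ≤ N * M := calc
    X₀ ≤ X₀ + 1 := Nat.le_succ _
    _ ≤ N := Nat.le_mul_of_pos_right _ hprod
    _ ≤ N * M := Nat.le_mul_of_pos_right _ (Nat.pos_of_ne_zero hM)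
  have hN_div (p) (hp : p ∈ s) : (N : ℝ) * (1 / p) = (N / p : ℕ) := by
    rw [Nat.cast_div ((Finset.dvd_prod_of_mem _ hp).mul_left _)
      (Nat.cast_ne_zero.mpr (hs p hp).1.ne_zero), mul_one_div]
  refine le_of_mul_le_mul_left ?_ (Nat.cast_pos.mpr hN : (0 : ℝ) < N)
  calc (N : ℝ) * ∑ p ∈ s, (1 / p : ℝ) = (∑ p ∈ s, N / p : ℕ) := by
        rw [Finset.mul_sum, Nat.cast_sum, Finset.sum_congr rfl hN_div]
    _ ≤ (Nat.card {I : Ideal (𝓞 K) // absNorm I ≤ N * M} : ℝ) :=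
        Nat.cast_le.mpr (sum_div_le_card_absNorm_le hM h hs N)
    _ ≤ C * (N * M : ℕ) := hC _ hX₀
    _ = N * (C * M) := by push_cast; ring

theorem summable_indicator_prime_coprime (hM : M ≠ 0)
    (h : ∀ p : ℕ, p.Prime → p.Coprime M → absNorm (P p) = p ∧ absNorm (Q p) = p ∧ P p ≠ Q p) :
    Summable ({p : ℕ | p.Prime ∧ p.Coprime M}.indicator (fun n : ℕ => (1 / n : ℝ))) := by
  classical
  obtain ⟨C, hC⟩ := exists_sum_one_div_le hM h
  refine summable_of_sum_le (c := C) (Set.indicator_nonneg fun _ _ => by positivity) fun s => ?_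
  rw [Finset.sum_indicator_eq_sum_filter]
  exact hC _ fun p hp => (Finset.mem_filter.mp hp).2

end Count

theorem not_summable_indicator_prime_coprime {M : ℕ} (hM : M ≠ 0) :
    ¬ Summable ({p : ℕ | p.Prime ∧ p.Coprime M}.indicator (fun n : ℕ => (1 / n : ℝ))) := by
  refine fun h => not_summable_one_div_on_primes ((summable_congr_cofinite ?_).mp h)
  filter_upwards [M.primeFactors.finite_toSet.compl_mem_cofinite] with p hp
  have hiff : p.Prime ∧ p.Coprime M ↔ p.Prime := and_iff_left_of_imp fun hprime =>
    hprime.coprime_iff_not_dvd.mpr fun hdvd => hp (Nat.mem_primeFactors.mpr ⟨hprime, hdvd, hM⟩)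
  simp only [Set.indicator_apply, Set.mem_ofPred_eq, hiff]

theorem exists_prime_forall_absNorm_eq (K : Type*) [Field K] [NumberField K] {M : ℕ} (hM : M ≠ 0) :
    ∃ p : ℕ, p.Prime ∧ p.Coprime M ∧
      ∀ P Q : Ideal (𝓞 K), absNorm P = p → absNorm Q = p → P = Q := by
  by_contra! h
  choose! P Q h using h
  exact not_summable_indicator_prime_coprime hM (summable_indicator_prime_coprime hM h)

theorem exponent_ne_zero_of_adjoin_eq_top {θ : 𝓞 K} (hθ : Algebra.adjoin ℚ {(θ : K)} = ⊤) :
    exponent θ ≠ 0 := by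
  have hint : IsIntegral ℤ (θ : K) := θ.isIntegral_coe
  let B := PowerBasis.ofAdjoinEqTop' hint.tower_top hθ
  have hgen : B.gen = (θ : K) := PowerBasis.ofAdjoinEqTop'_gen _ hθ
  obtain ⟨d, hd⟩ := IsIntegrallyClosed.isIntegral_iff.mp <|
    Algebra.discr_isIntegral (R := ℤ) ℚ (b := B.basis) fun i => by
      rw [B.basis_eq_pow, hgen]; exact hint.pow _
  have hd_ne : (d : 𝓞 K) ≠ 0 := by
    rw [Int.cast_ne_zero]
    rintro rfl
    exact Algebra.discr_not_zero_of_basis ℚ B.basis (by rw [← hd, map_zero])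
  have hmem : (d : 𝓞 K) ∈ conductor ℤ θ := by
    refine mem_conductor_iff.mpr fun x => ?_
    have hx := Algebra.discr_mul_isIntegral_mem_adjoin ℚ (hgen ▸ hint) x.isIntegral_coe
    rw [← hd, hgen, algebraMap_smul, zsmul_eq_mul] at hx
    have hadjoin : (Algebra.adjoin ℤ {θ}).map (IsScalarTower.toAlgHom ℤ (𝓞 K) K) =
        Algebra.adjoin ℤ {(θ : K)} := AlgHom.map_adjoin_singleton _ _
    obtain ⟨y, hy, hyx⟩ := hadjoin ▸ hx
    rwa [show (d : 𝓞 K) * x = y from RingOfIntegers.ext (by simpa using hyx.symm)]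
  refine mt absNorm_eq_zero_iff.mp fun h => hd_ne ?_
  rwa [eq_bot_of_comap_eq_bot h, Ideal.mem_bot] at hmem

theorem exists_absNorm_eq_of_splits {θ : 𝓞 K} {p : ℕ} [Fact p.Prime]
    (hp : ¬ p ∣ exponent θ) (hs : ((minpoly ℤ θ).map (Int.castRingHom (ZMod p))).Splits)
    (hsep : ((minpoly ℤ θ).map (Int.castRingHom (ZMod p))).Separable)
    (hdeg : 1 < (minpoly ℤ θ).natDegree) :
    ∃ P Q : Ideal (𝓞 K), absNorm P = p ∧ absNorm Q = p ∧ P ≠ Q := by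
  have hmonic : (minpoly ℤ θ).Monic := minpoly.monic θ.isIntegral
  set f := (minpoly ℤ θ).map (Int.castRingHom (ZMod p))
  have hmem {a : ZMod p} (ha : a ∈ f.roots) : X - C a ∈ monicFactorsMod θ p := by
    rw [Multiset.mem_toFinset, Polynomial.mem_normalizedFactors_iff (hmonic.map _).ne_zero]
    exact ⟨irreducible_X_sub_C a, monic_X_sub_C a, dvd_iff_isRoot.mpr (isRoot_of_mem_roots ha)⟩
  let 𝔭 (a) (ha : a ∈ f.roots) : primesOver (span {(p : ℤ)}) (𝓞 K) :=
    (NumberField.Ideal.primesOverSpanEquivMonicFactorsMod hp).symm ⟨X - C a, hmem ha⟩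
  have hnorm {a} (ha : a ∈ f.roots) : absNorm (𝔭 a ha).1 = p := by
    have h := NumberField.Ideal.inertiaDeg_primesOverSpanEquivMonicFactorsMod_symm_apply' hp
      (hmem ha)
    have : (𝔭 a ha).1.IsPrime := (𝔭 a ha).2.1
    have : (𝔭 a ha).1.LiesOver (span {(p : ℤ)}) := (𝔭 a ha).2.2
    rw [← Ideal.pow_inertiaDeg p (𝔭 a ha).1, h, natDegree_X_sub_C, pow_one]
  have hcard : f.roots.toFinset.card = (minpoly ℤ θ).natDegree := by
    rw [Multiset.toFinset_card_of_nodup (nodup_roots hsep), ← hs.natDegree_eq_card_roots,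
      hmonic.natDegree_map]
  obtain ⟨a, ha, b, hb, hab⟩ := Finset.one_lt_card.mp (hcard.symm ▸ hdeg)
  rw [Multiset.mem_toFinset] at ha hb
  refine ⟨(𝔭 a ha).1, (𝔭 b hb).1, hnorm ha, hnorm hb, fun h => hab ?_⟩
  have hX := (NumberField.Ideal.primesOverSpanEquivMonicFactorsMod hp).symm.injective
    (Subtype.ext h)
  exact C_injective (sub_right_injective (Subtype.ext_iff.mp hX))

theorem exists_mul_add_mul_eq_C_of_irreducible {R : Type*} [CommRing R] [IsDomain R]
    [IsIntegrallyClosed R] {f g : R[X]} (hm : f.Monic) (hf : Irreducible f) (hfg : ¬ f ∣ g) :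
    ∃ (u v : R[X]) (d : R), d ≠ 0 ∧ f * u + g * v = C d := by
  have hdeg : f.natDegree ≠ 0 := (hm.natDegree_pos_of_not_isUnit hf.not_isUnit).ne'
  obtain ⟨u, v, -, -, h⟩ := exists_mul_add_mul_eq_C_resultant f g le_rfl le_rfl (.inl hdeg)
  refine ⟨u, v, _, fun hres => ?_, h⟩
  have hcop : IsCoprime (f.map (algebraMap R (FractionRing R)))
      (g.map (algebraMap R (FractionRing R))) := by
    rw [((hm.irreducible_iff_irreducible_map_fraction_map).mp hf).coprime_iff_not_dvd,
      map_dvd_map _ (IsFractionRing.injective R _) hm]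
    exact hfg
  refine resultant_ne_zero _ _ hcop ?_
  rw [resultant_map_map, natDegree_map_eq_of_injective (IsFractionRing.injective R _),
    natDegree_map_eq_of_injective (IsFractionRing.injective R _), hres, map_zero]

theorem exists_forall_prime_separable_map {f : ℤ[X]} (hm : f.Monic) (hirr : Irreducible f) :
    ∃ D : ℕ, D ≠ 0 ∧ ∀ p : ℕ, p.Prime → p.Coprime D →
      (f.map (Int.castRingHom (ZMod p))).Separable := by
  have hdeg : 0 < f.natDegree := hm.natDegree_pos_of_not_isUnit hirr.not_isUnit
  have hdvd : ¬ f ∣ derivative f := hm.not_dvd_of_natDegree_lt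
    (mt derivative_eq_zero.mp hdeg.ne')
    (natDegree_derivative_lt hdeg.ne')
  obtain ⟨u, v, d, hd, h⟩ := exists_mul_add_mul_eq_C_of_irreducible hm hirr hdvd
  refine ⟨d.natAbs, Int.natAbs_ne_zero.mpr hd, fun p hp hpd => ?_⟩
  have : Fact p.Prime := ⟨hp⟩
  have hunit : (d : ZMod p) ≠ 0 := by
    rwa [Ne, ZMod.intCast_zmod_eq_zero_iff_dvd, Int.natCast_dvd, ← hp.coprime_iff_not_dvd]
  have hmap := congrArg (Polynomial.map (Int.castRingHom (ZMod p))) h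
  rw [Polynomial.map_add, Polynomial.map_mul, Polynomial.map_mul, ← derivative_map, map_C,
    Int.coe_castRingHom] at hmap
  refine ⟨C (d : ZMod p)⁻¹ * u.map (Int.castRingHom _),
    C (d : ZMod p)⁻¹ * v.map (Int.castRingHom _), ?_⟩
  rw [mul_assoc, mul_assoc, ← mul_add, mul_comm (u.map _), mul_comm (v.map _), hmap, ← C_mul,
    inv_mul_cancel₀ hunit, C_1]

theorem natDegree_minpoly_eq_one_of_forall_splits {θ : 𝓞 K}
    (hθ : Algebra.adjoin ℚ {(θ : K)} = ⊤)
    (hs : ∀ p : ℕ, p.Prime → ((minpoly ℤ θ).map (Int.castRingHom (ZMod p))).Splits) :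
    (minpoly ℤ θ).natDegree = 1 := by
  have hirr := minpoly.irreducible θ.isIntegral
  have hm : (minpoly ℤ θ).Monic := minpoly.monic θ.isIntegral
  by_contra hdeg
  obtain ⟨D, hD, hsep⟩ := exists_forall_prime_separable_map hm hirr
  obtain ⟨p, hp, hpM, hunique⟩ := exists_prime_forall_absNorm_eq K
    (mul_ne_zero (exponent_ne_zero_of_adjoin_eq_top hθ) hD)
  rw [Nat.coprime_mul_iff_right, hp.coprime_iff_not_dvd] at hpM
  have : Fact p.Prime := ⟨hp⟩
  obtain ⟨P, Q, hP, hQ, hPQ⟩ := exists_absNorm_eq_of_splits hpM.1 (hs p hp) (hsep p hp hpM.2)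
    (lt_of_le_of_ne (hm.natDegree_pos_of_not_isUnit hirr.not_isUnit) (Ne.symm hdeg))
  exact hPQ (hunique P Q hP hQ)

theorem natDegree_eq_one_of_forall_splits_map {f : ℤ[X]} (hm : f.Monic) (hirr : Irreducible f)
    (hs : ∀ p : ℕ, p.Prime → (f.map (Int.castRingHom (ZMod p))).Splits) : f.natDegree = 1 := by
  have : Fact (Irreducible (f.map (algebraMap ℤ ℚ))) :=
    ⟨hm.irreducible_iff_irreducible_map_fraction_map.mp hirr⟩
  have hne : f.map (algebraMap ℤ ℚ) ≠ 0 := (hm.map _).ne_zero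
  have : FiniteDimensional ℚ (AdjoinRoot (f.map (algebraMap ℤ ℚ))) :=
    (AdjoinRoot.powerBasis hne).finite
  have : NumberField (AdjoinRoot (f.map (algebraMap ℤ ℚ))) := ⟨⟩
  let x : AdjoinRoot (f.map (algebraMap ℤ ℚ)) := AdjoinRoot.root _
  have hx : aeval x f = 0 := by
    rw [← aeval_map_algebraMap ℚ]
    exact (AdjoinRoot.aeval_eq _).trans AdjoinRoot.mk_self
  let θ : 𝓞 (AdjoinRoot (f.map (algebraMap ℤ ℚ))) := ⟨x, f, hm, hx⟩
  have hθ : minpoly ℤ θ = f := by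
    refine eq_of_monic_of_associated (minpoly.monic θ.isIntegral) hm ?_
    exact (minpoly.irreducible θ.isIntegral).associated_of_dvd hirr
      (minpoly.isIntegrallyClosed_dvd θ.isIntegral <| RingOfIntegers.ext <|
        (aeval_algebraMap_apply _ θ f).symm.trans hx)
  rw [← hθ]
  exact natDegree_minpoly_eq_one_of_forall_splits AdjoinRoot.adjoinRoot_eq_top (by rwa [hθ])

end PrimeIdeals

section RationallyIrreducible

open Polynomial Relation
open scoped Pointwise

variable {R G A : Type*} [CommRing R] [Monoid G] [AddCommGroup A]

section ScalarStep

variable [Module R A]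

/-- The monoid acts by scalars on the factor `M / L` of a representation: the steps of a chain
that makes the action triangular. -/
def IsScalarStep (ρ : Representation R G A) (L M : Submodule R A) : Prop :=
  L ≤ M ∧ ∀ g, ∃ c : R, ∀ a ∈ M, ρ g a - c • a ∈ L

variable {ρ : Representation R G A} {L M : Submodule R A}

theorem IsScalarStep.apply_mem (h : IsScalarStep ρ L M) (g : G) {a : A} (ha : a ∈ L) :
    ρ g a ∈ L := by
  obtain ⟨c, hc⟩ := h.2 g
  simpa only [sub_add_cancel] using L.add_mem (hc a (h.1 ha)) (L.smul_mem c ha)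

theorem exists_isScalarStep_top_of_reflTransGen (h : ReflTransGen (IsScalarStep ρ) L ⊤)
    (hL : L ≠ ⊤) : ∃ N ≠ ⊤, L ≤ N ∧ IsScalarStep ρ N ⊤ := by
  induction h using ReflTransGen.head_induction_on with
  | refl => exact absurd rfl hL
  | @head L M hLM _ ih =>
    by_cases hM : M = ⊤
    · exact ⟨L, hL, le_rfl, hM ▸ hLM⟩
    · obtain ⟨N, hN, hMN, hstep⟩ := ih hM
      exact ⟨N, hN, hLM.1.trans hMN, hstep⟩

theorem exists_monic_splits_aeval_mem_of_reflTransGen (h : ReflTransGen (IsScalarStep ρ) L ⊤)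
    (g : G) : ∃ q : R[X], q.Monic ∧ q.Splits ∧ ∀ a, aeval (ρ g) q a ∈ L := by
  induction h using ReflTransGen.head_induction_on with
  | refl => exact ⟨1, monic_one, .one, fun _ => Submodule.mem_top⟩
  | head hLM _ ih =>
    obtain ⟨q, hq, hqs, hqM⟩ := ih
    obtain ⟨c, hc⟩ := hLM.2 g
    refine ⟨(X - C c) * q, (monic_X_sub_C c).mul hq, (Splits.X_sub_C c).mul hqs, fun a => ?_⟩
    simpa [Module.algebraMap_end_apply] using hc _ (hqM a)

variable (ρ) in
/-- The smallest subrepresentation modulo which `ρ` embeds into a product of representations on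
which the monoid acts by scalars. -/
def scalarRadical : Subrepresentation ρ where
  toSubmodule := sInf {L | IsScalarStep ρ L ⊤}
  apply_mem_toSubmodule g _ hv := Submodule.mem_sInf.mpr fun L hL =>
    IsScalarStep.apply_mem hL g (Submodule.mem_sInf.mp hv L hL)

theorem mem_of_mem_scalarRadical (h : IsScalarStep ρ L ⊤) {a : A} (ha : a ∈ scalarRadical ρ) :
    a ∈ L :=
  Submodule.mem_sInf.mp ha L h

theorem apply_apply_sub_mem_scalarRadical (g h : G) (a : A) :
    ρ g (ρ h a) - ρ h (ρ g a) ∈ scalarRadical ρ := by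
  refine Submodule.mem_sInf.mpr fun L hL => ?_
  obtain ⟨c, hc⟩ := hL.2 g
  obtain ⟨d, hd⟩ := hL.2 h
  have h₁ := hc (ρ h a) trivial
  have h₂ := hd (ρ g a) trivial
  have h₃ := L.smul_mem c (hd a trivial)
  have h₄ := L.smul_mem d (hc a trivial)
  convert L.sub_mem (L.add_mem h₁ h₃) (L.add_mem h₂ h₄) using 1
  module

end ScalarStep

/-- A representation is rationally irreducible if each nonzero subrepresentation contains a nonzero
multiple of the whole module; over a domain, this says that a torsion-free representation becomes
irreducible over the field of fractions. -/
def IsRationallyIrreducible [Module R A] (ρ : Representation R G A) : Prop :=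
  ∀ W : Subrepresentation ρ, W ≠ ⊥ → ∃ r : R, r ≠ 0 ∧ ∀ a, r • a ∈ W

theorem IsRationallyIrreducible.commute {ρ : Representation ℤ G A}
    (hρ : IsRationallyIrreducible ρ)
    (h : ∀ p : ℕ, p.Prime → ∃ L ≠ ⊤, (p : ℤ) • ⊤ ≤ L ∧ IsScalarStep ρ L ⊤) (g g' : G) :
    Commute (ρ g) (ρ g') := by
  have hbot : scalarRadical ρ = ⊥ := by
    by_contra hne
    obtain ⟨k, hk, hkA⟩ := hρ _ hne
    obtain ⟨p, hpk, hp⟩ := Nat.exists_infinite_primes (k.natAbs + 1)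
    obtain ⟨L, hL, hpL, hstep⟩ := h p hp
    obtain ⟨u, v, huv⟩ : IsCoprime (p : ℤ) k := Int.isCoprime_iff_gcd_eq_one.mpr <|
      Nat.coprime_of_lt_prime (Int.natAbs_ne_zero.mpr hk) hpk hp
    refine hL (eq_top_iff.mpr fun a _ => ?_)
    rw [← one_smul ℤ a, ← huv, add_smul, mul_smul, mul_smul]
    exact L.add_mem (L.smul_mem u (hpL (Submodule.smul_mem_pointwise_smul a _ ⊤ trivial)))
      (L.smul_mem v (mem_of_mem_scalarRadical hstep (hkA a)))
  refine LinearMap.ext fun a => sub_eq_zero.mp ?_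
  have := apply_apply_sub_mem_scalarRadical (ρ := ρ) g g' a
  rwa [hbot] at this

section Schur

variable [IsDomain R] [Module R A] [Module.IsTorsionFree R A] {ρ : Representation R G A}

theorem IsRationallyIrreducible.injective_of_commute (hρ : IsRationallyIrreducible ρ)
    {S : Module.End R A} (hS : ∀ g, Commute (ρ g) S) (hne : S ≠ 0) : Function.Injective S := by
  let W : Subrepresentation ρ :=
    ⟨LinearMap.ker S, fun g v hv => by
      rw [LinearMap.mem_ker, ← Module.End.mul_apply, ← (hS g).eq, Module.End.mul_apply,
        LinearMap.mem_ker.mp hv, map_zero]⟩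
  by_contra hinj
  have hW : W ≠ ⊥ := fun h => hinj (LinearMap.ker_eq_bot.mp (congrArg (·.toSubmodule) h))
  obtain ⟨r, hr, hrW⟩ := hρ W hW
  refine hne (LinearMap.ext fun a => (smul_eq_zero_iff_right hr).mp ?_)
  rw [← map_smul]
  exact hrW a

theorem IsRationallyIrreducible.isDomain_centralizer [Nontrivial A]
    (hρ : IsRationallyIrreducible ρ) : IsDomain (Subalgebra.centralizer R (Set.range ρ)) := by
  have : NoZeroDivisors (Subalgebra.centralizer R (Set.range ρ)) := by
    refine ⟨fun {S T} hST => or_iff_not_imp_left.mpr fun hS => Subtype.ext ?_⟩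
    have hinj := hρ.injective_of_commute
      (fun g => (Subalgebra.mem_centralizer_iff R).mp S.2 _ ⟨g, rfl⟩)
      (fun h => hS (Subtype.ext h))
    refine LinearMap.ext fun a => hinj ?_
    rw [← Module.End.mul_apply, ← MulMemClass.coe_mul, hST]
    simp
  exact NoZeroDivisors.to_isDomain _

end Schur

theorem dvd_of_aeval_eq_zero_of_irreducible [IsDomain R] [IsIntegrallyClosed R] [Module R A]
    [Module.IsTorsionFree R A] [Nontrivial A] {T : Module.End R A} {f g : R[X]} (hm : f.Monic)
    (hirr : Irreducible f) (hf : aeval T f = 0) (hg : aeval T g = 0) : f ∣ g := by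
  by_contra hfg
  obtain ⟨u, v, d, hd, h⟩ := exists_mul_add_mul_eq_C_of_irreducible hm hirr hfg
  obtain ⟨a, ha⟩ := exists_ne (0 : A)
  have hda : d • a = 0 := by
    simpa [hf, hg] using (LinearMap.congr_fun (congrArg (aeval T) h) a).symm
  exact smul_ne_zero hd ha hda

theorem splits_map_of_aeval_mem [IsDomain R] [IsIntegrallyClosed R] [Module R A]
    [Module.IsTorsionFree R A] [Module.Finite R A] [Nontrivial A] {k : Type*} [Field k]
    (φ : R →+* k) {T : Module.End R A} {f q : R[X]} (hm : f.Monic) (hirr : Irreducible f)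
    (hf : aeval T f = 0) (hq : q.Monic) (hqs : q.Splits)
    (hqT : ∀ a, aeval T q a ∈ RingHom.ker φ • (⊤ : Submodule R A)) : (f.map φ).Splits := by
  -- By Cayley–Hamilton, `q(T)` is a root of a polynomial congruent to `X ^ n` modulo `ker φ`.
  obtain ⟨Q, hQm, -, hQc, hQ⟩ :=
    LinearMap.exists_monic_and_natDegree_eq_and_coeff_mem_pow_and_aeval_eq_zero R (aeval T q)
      (RingHom.ker φ) (LinearMap.range_le_iff_comap.mpr (eq_top_iff.mpr fun a _ => hqT a))
  have hmap : Q.map φ = X ^ Q.natDegree := by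
    ext n
    rw [coeff_map, coeff_X_pow]
    rcases lt_trichotomy n Q.natDegree with hn | rfl | hn
    · rw [if_neg hn.ne]
      exact Ideal.pow_le_self (Nat.sub_ne_zero_of_lt hn) (hQc n)
    · rw [if_pos rfl, hQm.coeff_natDegree, map_one]
    · rw [if_neg hn.ne', coeff_eq_zero_of_natDegree_lt hn, map_zero]
  have hdvd : f.map φ ∣ q.map φ ^ Q.natDegree := by
    rw [← X_pow_comp, ← hmap, ← Polynomial.map_comp]
    exact map_dvd φ (dvd_of_aeval_eq_zero_of_irreducible hm hirr hf (by rw [aeval_comp, hQ]))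
  exact ((hqs.map φ).pow _).of_dvd (pow_ne_zero _ (hq.map φ).ne_zero) hdvd

section Lattice

variable [Module.Finite ℤ A] [Module.IsTorsionFree ℤ A] [Nontrivial A]

theorem smul_top_ne_top {n : ℤ} (hn : ¬ IsUnit n) : n • (⊤ : Submodule ℤ A) ≠ ⊤ := by
  intro htop
  obtain ⟨r, hr, hrA⟩ := Submodule.exists_sub_one_mem_and_smul_eq_zero_of_fg_of_le_smul
    (Ideal.span {n}) (⊤ : Submodule ℤ A) Module.Finite.fg_top
    (by rw [Submodule.ideal_span_singleton_smul, htop])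
  obtain ⟨a, ha⟩ := exists_ne (0 : A)
  obtain rfl := (smul_eq_zero.mp (hrA a trivial)).resolve_right ha
  rw [zero_sub, Ideal.neg_mem_iff, Ideal.mem_span_singleton] at hr
  exact hn (isUnit_of_dvd_one hr)

theorem IsRationallyIrreducible.exists_apply_eq_smul {ρ : Representation ℤ G A}
    (hρ : IsRationallyIrreducible ρ)
    (h : ∀ p : ℕ, p.Prime → ReflTransGen (IsScalarStep ρ) ((p : ℤ) • ⊤) ⊤) (g : G) :
    ∃ c : ℤ, ∀ a, ρ g a = c • a := by
  have hcomm := hρ.commute fun p hp =>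
    exists_isScalarStep_top_of_reflTransGen (h p hp)
      (smul_top_ne_top (Nat.prime_iff_prime_int.mp hp).not_isUnit)
  let T : Subalgebra.centralizer ℤ (Set.range ρ) :=
    ⟨ρ g, by rintro _ ⟨g', rfl⟩; exact hcomm g' g⟩
  have := hρ.isDomain_centralizer
  have hint : IsIntegral ℤ T := (isIntegral_algHom_iff (Subalgebra.val _)
    Subtype.val_injective).mp (Algebra.IsIntegral.isIntegral (ρ g))
  have hirr := minpoly.irreducible hint
  have hmin : aeval (ρ g) (minpoly ℤ T) = 0 := by
    rw [show ρ g = Subalgebra.val _ T from rfl, aeval_algHom_apply, minpoly.aeval, map_zero]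
  have hdeg : (minpoly ℤ T).natDegree = 1 := by
    refine natDegree_eq_one_of_forall_splits_map (minpoly.monic hint) hirr fun p hp => ?_
    have : Fact p.Prime := ⟨hp⟩
    obtain ⟨q, hq, hqs, hqT⟩ := exists_monic_splits_aeval_mem_of_reflTransGen (h p hp) g
    refine splits_map_of_aeval_mem _ (minpoly.monic hint) hirr hmin hq hqs ?_
    rwa [ZMod.ker_intCastRingHom, Submodule.ideal_span_singleton_smul]
  rw [(minpoly.monic hint).eq_X_add_C hdeg, map_add, aeval_X, aeval_C] at hmin
  refine ⟨-(minpoly ℤ T).coeff 0, fun a => ?_⟩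
  rw [neg_smul]
  exact eq_neg_of_add_eq_zero_left (LinearMap.congr_fun hmin a)

end Lattice

/-- The subrepresentation `r A` of a representation on `A`. -/
def smulTop [Module R A] (ρ : Representation R G A) (r : R) : Subrepresentation ρ where
  toSubmodule := r • ⊤
  apply_mem_toSubmodule g _ hv := by
    obtain ⟨a, -, rfl⟩ := (Submodule.mem_smul_pointwise_iff_exists _ _ _).mp hv
    rw [map_smul]
    exact Submodule.smul_mem_pointwise_smul _ _ _ trivial

theorem exists_smul_top_ne_bot_isTorsionFree (A : Type*) [AddCommGroup A] [Module.Finite ℤ A]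
    [Infinite A] :
    ∃ m : ℤ, m • (⊤ : Submodule ℤ A) ≠ ⊥ ∧ Module.IsTorsionFree ℤ ↥(m • (⊤ : Submodule ℤ A)) := by
  have hfin : Finite (Submodule.torsion ℤ A) :=
    Module.finite_of_fg_torsion _ Submodule.torsion_isTorsion
  obtain ⟨m, hm, hmA⟩ : ∃ m : ℤ, m ≠ 0 ∧ ∀ t : Submodule.torsion ℤ A, m • t = 0 :=
    ⟨Nat.card (Submodule.torsion ℤ A), Nat.cast_ne_zero.mpr Nat.card_pos.ne', fun t => by
      rw [natCast_zsmul, card_nsmul_eq_zero']⟩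
  have htors (k : ℤ) (hk : k ≠ 0) (a : A) (ha : k • a = 0) : m • a = 0 :=
    congrArg Subtype.val (hmA ⟨a, ⟨k, mem_nonZeroDivisors_of_ne_zero hk⟩, ha⟩)
  refine ⟨m, fun h => ?_, ?_⟩
  · have : Module.IsTorsion ℤ A := fun {a} => ⟨⟨m, mem_nonZeroDivisors_of_ne_zero hm⟩,
      (Submodule.mem_bot ℤ).mp (h ▸ Submodule.smul_mem_pointwise_smul a m ⊤ trivial)⟩
    have := Module.finite_of_fg_torsion A this
    exact not_finite A
  · refine .of_smul_eq_zero fun k ⟨x, hx⟩ hkx => or_iff_not_imp_left.mpr fun hk => ?_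
    obtain ⟨a, -, rfl⟩ := (Submodule.mem_smul_pointwise_iff_exists _ _ _).mp hx
    refine Subtype.ext (htors (k * m) (mul_ne_zero hk hm) a ?_)
    rw [mul_smul]
    exact congrArg Subtype.val hkx

theorem isRationallyIrreducible_of_forall_finrank_le {ρ : Representation ℤ G A}
    [Module.Finite ℤ A] [Module.IsTorsionFree ℤ A]
    (h : ∀ W : Subrepresentation ρ, W ≠ ⊥ →
      Module.finrank ℤ A ≤ Module.finrank ℤ W.toSubmodule) : IsRationallyIrreducible ρ := by
  intro W hW
  have : Finite (A ⧸ W.toSubmodule) := Submodule.finiteQuotientOfFreeOfRankEq _ <|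
    (Submodule.finrank_le _).antisymm (h W hW)
  refine ⟨Nat.card (A ⧸ W.toSubmodule), Nat.cast_ne_zero.mpr Nat.card_pos.ne', fun a => ?_⟩
  rw [natCast_zsmul]
  exact W.toSubmodule.toAddSubgroup.nsmul_index_mem a

theorem exists_isRationallyIrreducible [Module.Finite ℤ A] [Infinite A]
    (ρ : Representation ℤ G A) : ∃ W : Subrepresentation ρ, Nontrivial W.toSubmodule ∧
      Module.IsTorsionFree ℤ W.toSubmodule ∧ IsRationallyIrreducible W.toRepresentation := by
  obtain ⟨m, hm, hm'⟩ := exists_smul_top_ne_bot_isTorsionFree A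
  obtain ⟨W, ⟨hW, hWtf⟩, hmin⟩ := exists_minimalFor_of_wellFoundedLT
    (fun W : Subrepresentation ρ => Nontrivial W.toSubmodule ∧ Module.IsTorsionFree ℤ W.toSubmodule)
    (fun W => Module.finrank ℤ W.toSubmodule)
    ⟨smulTop ρ m, (Submodule.nontrivial_iff_ne_bot).mpr hm, hm'⟩
  refine ⟨W, hW, hWtf, isRationallyIrreducible_of_forall_finrank_le fun V hV => ?_⟩
  let V' : Subrepresentation ρ :=
    ⟨V.toSubmodule.map W.toSubmodule.subtype, by
      rintro g _ ⟨v, hv, rfl⟩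
      exact ⟨_, V.apply_mem_toSubmodule g hv, rfl⟩⟩
  let e : V.toSubmodule ≃ₗ[ℤ] V'.toSubmodule :=
    V.toSubmodule.equivMapOfInjective _ W.toSubmodule.subtype_injective
  have : Nontrivial V.toSubmodule := (Submodule.nontrivial_iff_ne_bot).mpr fun h =>
    hV (Subrepresentation.toSubmodule_injective h)
  rw [e.finrank_eq]
  refine le_of_not_gt fun hlt => hlt.not_ge (hmin ⟨e.symm.toEquiv.nontrivial, ?_⟩ hlt.le)
  exact e.symm.injective.moduleIsTorsionFree _ (map_smul e.symm)

end RationallyIrreducible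

section FinitelyGenerated

variable {G Q : Type*} [AddGroup G] [AddGroup Q] {H K : AddSubgroup G}

theorem addSubgroup_fg_map (hH : H.FG) (f : G →+ Q) : (H.map f).FG := by
  rw [AddSubgroup.fg_iff_addSubmonoid_fg] at hH ⊢
  exact hH.map f

theorem addSubgroup_fg_of_map_fg (f : G →+ Q) (hmap : (H.map f).FG) (hker : (H ⊓ f.ker).FG) :
    H.FG := by
  classical
  obtain ⟨S, hS⟩ := hmap
  obtain ⟨E, hEH, rfl⟩ : ∃ E : Finset G, (E : Set G) ⊆ H ∧ E.image f = S :=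
    Finset.subset_set_image_iff.mp (AddSubgroup.subset_closure.trans hS.le)
  have hsup : AddSubgroup.closure E ⊔ H ⊓ f.ker = H := by
    have hle : AddSubgroup.closure (E : Set G) ≤ H := (AddSubgroup.closure_le H).mpr hEH
    refine le_antisymm (sup_le hle inf_le_left) fun a ha => ?_
    have hfa : f a ∈ (AddSubgroup.closure (E : Set G)).map f := by
      rw [AddMonoidHom.map_closure, ← Finset.coe_image, hS]
      exact ⟨a, ha, rfl⟩
    obtain ⟨s, hs, hsa⟩ := hfa
    have hdiff : -s + a ∈ H ⊓ f.ker :=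
      ⟨H.add_mem (H.neg_mem (hle hs)) ha, AddMonoidHom.mem_ker.mpr (by simp [hsa])⟩
    simpa using AddSubgroup.add_mem_sup hs hdiff
  rw [← hsup]
  exact AddSubgroup.FG.sup ⟨E, rfl⟩ hker

theorem addSubgroup_fg_of_le_of_commute (hcomm : ∀ a ∈ K, ∀ b ∈ K, a + b = b + a) (hK : K.FG)
    (hHK : H ≤ K) : H.FG := by
  let _ : AddCommGroup K :=
    { (inferInstance : AddGroup K) with add_comm := fun a b => Subtype.ext (hcomm a a.2 b b.2) }
  have : Module.Finite ℤ K :=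
    Module.Finite.iff_addGroup_fg.mpr ((AddGroup.fg_iff_addSubgroup_fg K).mpr hK)
  have hfg : (H.addSubgroupOf K).FG :=
    Submodule.fg_iff_addSubgroup_fg _ |>.mp
      (IsNoetherian.noetherian (AddSubgroup.toIntSubmodule (H.addSubgroupOf K)))
  have := addSubgroup_fg_map hfg K.subtype
  rwa [AddSubgroup.addSubgroupOf_map_subtype, inf_eq_left.mpr hHK] at this

theorem wellFoundedGT_addSubgroup_of_forall_fg (h : ∀ H : AddSubgroup G, H.FG) :
    WellFoundedGT (AddSubgroup G) := by
  rw [wellFoundedGT_iff_monotone_chain_condition]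
  intro f
  obtain ⟨E, hE⟩ := h (⨆ n, f n)
  have hmem : ∀ e ∈ E, ∃ n, e ∈ f n := fun e he => by
    rw [← AddSubgroup.mem_iSup_of_directed f.monotone.directed_le, ← hE]
    exact AddSubgroup.subset_closure he
  choose! n hn using hmem
  refine ⟨E.sup n, fun m hm => le_antisymm (f.monotone hm) ((le_iSup f m).trans ?_)⟩
  rw [← hE, AddSubgroup.closure_le]
  exact fun e he => f.monotone (Finset.le_sup he) (hn e he)

end FinitelyGenerated

namespace SkewBrace

open Relation

section Lambda

variable {B : Type*} [SkewBrace B]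

theorem mul_eq_add_lam (a b : B) : a * b = a + lam a b := by
  rw [lam, add_neg_cancel_left]

/-- The map `λ_a` as an additive endomorphism. -/
def lamHom (a : B) : B →+ B where
  toFun := lam a
  map_zero' := by rw [lam, mul_zero_eq, neg_add_cancel]
  map_add' b c := by simp only [lam, mul_add_eq, sub_eq_add_neg, add_assoc]

theorem lam_zero (a : B) : lam a 0 = 0 := map_zero (lamHom a)

theorem lam_add (a b c : B) : lam a (b + c) = lam a b + lam a c := map_add (lamHom a) b c

theorem lam_zsmul (a : B) (k : ℤ) (b : B) : lam a (k • b) = k • lam a b :=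
  map_zsmul (lamHom a) k b

theorem lam_one (b : B) : lam 1 b = b := by
  rw [lam, one_mul, one_eq_zero, neg_zero, zero_add]

theorem lam_mul (a b c : B) : lam (a * b) c = lam a (lam b c) := by
  apply add_left_cancel (a := a * b)
  rw [← mul_eq_add_lam, mul_assoc, mul_eq_add_lam b c, mul_add_eq, sub_eq_add_neg, add_assoc,
    lam.eq_1 a]

theorem lam_inv_lam (a b : B) : lam a⁻¹ (lam a b) = b := by
  rw [← lam_mul, inv_mul_cancel, lam_one]

theorem lam_lam_inv (a b : B) : lam a (lam a⁻¹ b) = b := by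
  rw [← lam_mul, mul_inv_cancel, lam_one]

theorem lam_mem_center (a : B) {b : B} (hb : b ∈ AddSubgroup.center B) :
    lam a b ∈ AddSubgroup.center B := by
  rw [AddSubgroup.mem_center_iff] at hb ⊢
  intro g
  rw [← lam_lam_inv a g, ← lam_add, ← lam_add, hb]

end Lambda

section Socle

variable {B : Type*} [SkewBrace B]

theorem mul_eq_add_of_mem_socle {a : B} (ha : a ∈ socle B) (b : B) : a * b = a + b := by
  rw [mul_eq_add_lam, ha.1]

theorem inv_eq_neg_of_mem_socle {a : B} (ha : a ∈ socle B) : a⁻¹ = -a := by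
  rw [eq_comm, neg_eq_iff_add_eq_zero, ← mul_eq_add_of_mem_socle ha, mul_inv_cancel, one_eq_zero]

theorem mul_conj_eq_lam_of_mem_socle (b : B) {a : B} (ha : a ∈ socle B) :
    b * a * b⁻¹ = lam b a := by
  have hlam (x : B) : lam (b * a * b⁻¹) x = x := by rw [lam_mul, lam_mul, ha.1, lam_lam_inv]
  apply add_right_cancel (b := b)
  calc b * a * b⁻¹ + b = b * a * b⁻¹ * b := by rw [mul_eq_add_lam (b * a * b⁻¹) b, hlam]
    _ = b + lam b a := by rw [inv_mul_cancel_right, mul_eq_add_lam]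
    _ = lam b a + b := AddSubgroup.mem_center_iff.mp (lam_mem_center b ha.2) b

theorem lam_mem_socle (b : B) {a : B} (ha : a ∈ socle B) : lam b a ∈ socle B := by
  refine ⟨fun x => ?_, lam_mem_center b ha.2⟩
  rw [← mul_conj_eq_lam_of_mem_socle b ha, lam_mul, lam_mul, ha.1, lam_lam_inv]

/-- The socle as a subgroup of `(B, +)`. -/
def socleAddSubgroup (B : Type*) [SkewBrace B] : AddSubgroup B where
  carrier := socle B
  zero_mem' := ⟨fun b => by rw [← one_eq_zero, lam_one], zero_mem _⟩
  add_mem' {a b} ha hb :=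
    ⟨fun x => by rw [← mul_eq_add_of_mem_socle ha, lam_mul, hb.1, ha.1], add_mem ha.2 hb.2⟩
  neg_mem' {a} ha :=
    ⟨fun x => by rw [← inv_eq_neg_of_mem_socle ha, ← ha.1 (lam a⁻¹ x), lam_lam_inv],
      neg_mem ha.2⟩

theorem inv_mul_mem_socle {a b : B} (hlam : ∀ x, lam a x = lam b x)
    (hconj : ∀ x, a + x + -a = b + x + -b) : a⁻¹ * b ∈ socle B := by
  refine ⟨fun x => by rw [lam_mul, ← hlam, lam_inv_lam], ?_⟩
  rw [← lam_inv_neg_add]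
  refine lam_mem_center _ (AddSubgroup.mem_center_iff.mpr fun x => ?_)
  have h := congrArg (fun y => -a + y + b) (hconj x)
  simpa only [add_assoc, neg_add_cancel, neg_add_cancel_left, add_zero] using h

end Socle

section Ideals

variable {B : Type*} [SkewBrace B]

instance : AddSubgroupClass (Ideal B) B where
  add_mem {I} _ _ ha hb := I.toAddSubgroup.add_mem ha hb
  zero_mem I := I.toAddSubgroup.zero_mem
  neg_mem {I} _ ha := I.toAddSubgroup.neg_mem ha

instance : PartialOrder (Ideal B) := .ofSetLike (Ideal B) B

/-- The additive subgroups of the socle that are invariant under all `λ_b` are ideals. -/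
def Ideal.ofLESocle (H : AddSubgroup B) (hsoc : ∀ a ∈ H, a ∈ socle B)
    (hlam : ∀ b : B, ∀ a ∈ H, lam b a ∈ H) : Ideal B where
  toAddSubgroup := H
  mul_mem' {a b} ha hb := by
    rw [mul_eq_add_of_mem_socle (hsoc a ha)]
    exact H.add_mem ha hb
  inv_mem' {a} ha := by
    rw [inv_eq_neg_of_mem_socle (hsoc a ha)]
    exact H.neg_mem ha
  lam_mem' b a ha := hlam b a ha
  add_conj_mem' b a ha := by
    rwa [AddSubgroup.mem_center_iff.mp (hsoc a ha).2 b, add_neg_cancel_right]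
  mul_conj_mem' b a ha := by
    rw [mul_conj_eq_lam_of_mem_socle b (hsoc a ha)]
    exact hlam b a ha

instance : BoundedOrder (Ideal B) where
  bot := .ofLESocle ⊥ (fun _ ha => ha ▸ (socleAddSubgroup B).zero_mem) fun b _ ha =>
    ha ▸ lam_zero b
  bot_le I _ ha := ha ▸ zero_mem I
  top :=
    { (⊤ : AddSubgroup B) with
      mul_mem' := fun _ _ => trivial
      inv_mem' := fun _ => trivial
      lam_mem' := fun _ _ _ => trivial
      add_conj_mem' := fun _ _ _ => trivial
      mul_conj_mem' := fun _ _ _ => trivial }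
  le_top _ _ _ := trivial

theorem Ideal.mem_bot {a : B} : a ∈ (⊥ : Ideal B) ↔ a = 0 := Iff.rfl

theorem Ideal.coe_eq_zero_iff {I : Ideal B} : (I : Set B) = {0} ↔ I = ⊥ :=
  SetLike.coe_set_eq (q := ⊥)

theorem Ideal.coe_eq_univ_iff {I : Ideal B} : (I : Set B) = Set.univ ↔ I = ⊤ :=
  SetLike.coe_set_eq (q := ⊤)

variable (I : Ideal B)

theorem Ideal.toQuot_lam (a b : B) : I.toQuot (lam a b) = lam (I.toQuot a) (I.toQuot b) := rfl

theorem Ideal.toQuot_zsmul (k : ℤ) (a : B) : I.toQuot (k • a) = k • I.toQuot a := rfl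

theorem Ideal.toQuot_eq_iff {a b : B} : I.toQuot a = I.toQuot b ↔ -a + b ∈ I :=
  QuotientAddGroup.eq

theorem Ideal.toQuot_eq_zero_iff {a : B} : I.toQuot a = 0 ↔ a ∈ I :=
  QuotientAddGroup.eq_zero_iff a

end Ideals

section BraceHom

variable {B C : Type*} [SkewBrace B] [SkewBrace C]

instance : FunLike (BraceHom B C) B C where
  coe := BraceHom.toFun
  coe_injective f g h := by
    cases f
    cases g
    congr

instance : AddMonoidHomClass (BraceHom B C) B C where
  map_add := BraceHom.map_add'
  map_zero f := (AddMonoidHom.mk' f f.map_add').map_zero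

instance : MonoidHomClass (BraceHom B C) B C where
  map_mul := BraceHom.map_mul'
  map_one f := (MonoidHom.mk' f f.map_mul').map_one

namespace BraceHom

variable (f : BraceHom B C)

theorem map_lam (a b : B) : f (lam a b) = lam (f a) (f b) := by
  rw [lam, map_add, map_neg, map_mul, lam]

theorem map_mem_socle_iff (hf : Function.Surjective f) {a : B} :
    f a ∈ socle C ↔ ∀ b, f (lam a b) = f b ∧ f (b + a) = f (a + b) := by
  simp only [map_lam, map_add, forall_and, socle, Set.mem_ofPred_eq, AddSubgroup.mem_center_iff,
    hf.forall]

/-- The preimage of an ideal. -/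
def comap (I : Ideal C) : Ideal B where
  toAddSubgroup := I.toAddSubgroup.comap (f : B →+ C)
  mul_mem' {a b} ha hb := by simpa using I.mul_mem' ha hb
  inv_mem' {a} ha := by simpa using I.inv_mem' ha
  lam_mem' b a ha := by simpa [map_lam] using I.lam_mem' (f b) ha
  add_conj_mem' b a ha := by simpa using I.add_conj_mem' (f b) ha
  mul_conj_mem' b a ha := by simpa using I.mul_conj_mem' (f b) ha

/-- The image of an ideal under a surjective homomorphism. -/
def map (hf : Function.Surjective f) (I : Ideal B) : Ideal C where
  toAddSubgroup := I.toAddSubgroup.map (f : B →+ C)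
  mul_mem' := by
    rintro _ _ ⟨a, ha, rfl⟩ ⟨b, hb, rfl⟩
    exact ⟨a * b, I.mul_mem' ha hb, map_mul f a b⟩
  inv_mem' := by
    rintro _ ⟨a, ha, rfl⟩
    exact ⟨a⁻¹, I.inv_mem' ha, map_inv f a⟩
  lam_mem' := hf.forall.mpr <| by
    rintro b _ ⟨a, ha, rfl⟩
    exact ⟨lam b a, I.lam_mem' b ha, f.map_lam b a⟩
  add_conj_mem' := hf.forall.mpr <| by
    rintro b _ ⟨a, ha, rfl⟩
    exact ⟨b + a + -b, I.add_conj_mem' b ha, by simp⟩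
  mul_conj_mem' := hf.forall.mpr <| by
    rintro b _ ⟨a, ha, rfl⟩
    exact ⟨b * a * b⁻¹, I.mul_conj_mem' b ha, by simp⟩

theorem mem_comap {I : Ideal C} {a : B} : a ∈ f.comap I ↔ f a ∈ I := Iff.rfl

variable (hf : Function.Surjective f)

theorem map_bot : f.map hf ⊥ = ⊥ :=
  eq_bot_iff.mpr <| by
    rintro _ ⟨_, rfl, rfl⟩
    exact map_zero f

theorem map_top : f.map hf ⊤ = ⊤ :=
  eq_top_iff.mpr fun c _ => (hf c).imp fun _ hb => ⟨trivial, hb⟩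

theorem map_comap (I : Ideal C) : f.map hf (f.comap I) = I :=
  SetLike.coe_injective (Set.image_preimage_eq (I : Set C) hf)

end BraceHom

/-- The quotient map as a homomorphism of braces. -/
def Ideal.quotHom (I : Ideal B) : BraceHom B I.Quot where
  toFun := I.toQuot
  map_add' := I.toQuot_add
  map_mul' := I.toQuot_mul

theorem Ideal.quotHom_surjective (I : Ideal B) : Function.Surjective I.quotHom :=
  QuotientAddGroup.mk_surjective

theorem Ideal.comap_quotHom_bot (I : Ideal B) : I.quotHom.comap ⊥ = I :=
  SetLike.ext fun _ => I.toQuot_eq_zero_iff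

theorem Ideal.le_comap_quotHom (I : Ideal B) (K : Ideal I.Quot) : I ≤ I.quotHom.comap K := by
  intro a ha
  have h : I.quotHom a = 0 := I.toQuot_eq_zero_iff.mpr ha
  rw [BraceHom.mem_comap, h]
  exact zero_mem K

end BraceHom

section Steps

variable {B : Type*} [SkewBrace B] {I J : Ideal B} {x : B}

theorem toQuot_mem_factor_iff (h : I ≤ J) {a : B} : I.toQuot a ∈ I.factor J ↔ a ∈ J := by
  refine ⟨?_, fun ha => ⟨a, ha, rfl⟩⟩
  rintro ⟨b, hb, hba⟩
  have := add_mem (show b ∈ J from hb) (h (I.toQuot_eq_iff.mp hba))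
  rwa [add_neg_cancel_left] at this

theorem toQuot_mem_socle_iff {a : B} : I.toQuot a ∈ socle I.Quot ↔
    ∀ b, I.toQuot (lam a b) = I.toQuot b ∧ I.toQuot (b + a) = I.toQuot (a + b) :=
  I.quotHom.map_mem_socle_iff I.quotHom_surjective

/-- `J` lies in the socle modulo `I`. -/
def SocleMod (I J : Ideal B) : Prop :=
  ∀ a ∈ J, I.toQuot a ∈ socle I.Quot

theorem factor_subset_socle_iff :
    (I.factor J : Set I.Quot) ⊆ socle I.Quot ↔ SocleMod I J :=
  Set.image_subset_iff

/-- `J` is generated by `I` and `x` as an additive subgroup, so that the factor `J / I` is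
cyclic. -/
def IsGeneratedOver (I J : Ideal B) (x : B) : Prop :=
  ∀ y, y ∈ J ↔ I.toQuot y ∈ AddSubgroup.zmultiples (I.toQuot x)

theorem isGeneratedOver_iff_zmultiples_eq : IsGeneratedOver I J x ↔
    I ≤ J ∧ AddSubgroup.zmultiples (I.toQuot x) = (I.factor J).toAddSubgroup := by
  constructor
  · intro h
    have hIJ : I ≤ J := fun y hy =>
      (h y).mpr ((I.toQuot_eq_zero_iff.mpr hy).symm ▸ zero_mem _)
    refine ⟨hIJ, SetLike.ext fun q => ?_⟩
    obtain ⟨y, rfl⟩ := I.quotHom_surjective q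
    exact (h y).symm.trans (toQuot_mem_factor_iff hIJ).symm
  · rintro ⟨hIJ, h⟩ y
    rw [h]
    exact (toQuot_mem_factor_iff hIJ).symm

theorem isGeneratedOver_iff :
    IsGeneratedOver I J x ↔ ∀ y, y ∈ J ↔ ∃ k : ℤ, -(k • x) + y ∈ I := by
  simp only [IsGeneratedOver, AddSubgroup.mem_zmultiples_iff, ← I.toQuot_zsmul, I.toQuot_eq_iff]

theorem IsGeneratedOver.le (h : IsGeneratedOver I J x) : I ≤ J :=
  (isGeneratedOver_iff_zmultiples_eq.mp h).1

theorem IsGeneratedOver.mem (h : IsGeneratedOver I J x) : x ∈ J :=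
  (h x).mpr (AddSubgroup.mem_zmultiples _)

theorem IsGeneratedOver.eq_of_mem (h : IsGeneratedOver I J x) (hx : x ∈ I) : I = J := by
  refine h.le.antisymm fun y hy => I.toQuot_eq_zero_iff.mp ?_
  simpa [I.toQuot_eq_zero_iff.mpr hx] using (h y).mp hy

theorem IsGeneratedOver.socleMod (h : IsGeneratedOver I J x) (hx : I.toQuot x ∈ socle I.Quot) :
    SocleMod I J := fun y hy =>
  (AddSubgroup.zmultiples_le (H := socleAddSubgroup I.Quot)).mpr hx ((h y).mp hy)

theorem IsGeneratedOver.exists_toQuot_lam_eq_zsmul (h : IsGeneratedOver I J x) (b : B) :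
    ∃ c : ℤ, ∀ y ∈ J, I.toQuot (lam b y) = c • I.toQuot y := by
  obtain ⟨c, hc⟩ := AddSubgroup.mem_zmultiples_iff.mp ((h _).mp (J.lam_mem' b h.mem))
  refine ⟨c, fun y hy => ?_⟩
  obtain ⟨k, hk⟩ := AddSubgroup.mem_zmultiples_iff.mp ((h y).mp hy)
  calc I.toQuot (lam b y) = lam (I.toQuot b) (k • I.toQuot x) := by rw [I.toQuot_lam, hk]
    _ = k • c • I.toQuot x := by rw [lam_zsmul, ← I.toQuot_lam, ← hc]
    _ = c • I.toQuot y := by rw [smul_comm, hk]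

theorem exists_isGeneratedOver (hx : I.toQuot x ∈ socle I.Quot)
    (hlam : ∀ b, ∃ c : ℤ, I.toQuot (lam b x) = c • I.toQuot x) : ∃ J, IsGeneratedOver I J x := by
  have hlam' (b : I.Quot) (q) (hq : q ∈ AddSubgroup.zmultiples (I.toQuot x)) :
      lam b q ∈ AddSubgroup.zmultiples (I.toQuot x) := by
    obtain ⟨b, rfl⟩ := I.quotHom_surjective b
    obtain ⟨k, rfl⟩ := AddSubgroup.mem_zmultiples_iff.mp hq
    obtain ⟨c, hc⟩ := hlam b
    refine AddSubgroup.mem_zmultiples_iff.mpr ⟨k * c, ?_⟩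
    rw [lam_zsmul, mul_smul, ← hc]
    rfl
  have hsoc : AddSubgroup.zmultiples (I.toQuot x) ≤ socleAddSubgroup I.Quot :=
    AddSubgroup.zmultiples_le.mpr hx
  exact ⟨I.quotHom.comap (.ofLESocle _ (fun _ hq => hsoc hq) hlam'), fun _ => Iff.rfl⟩

/-- One step of a chain of ideals witnessing supersolubility: `J / I` is infinite cyclic and
contained in the socle of `B / I`, or of prime order. -/
def SupersolubleStep (I J : Ideal B) : Prop :=
  ∃ x, IsGeneratedOver I J x ∧
    (addOrderOf (I.toQuot x) = 0 ∧ SocleMod I J ∨ (addOrderOf (I.toQuot x)).Prime)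

/-- One step of a chain of ideals witnessing almost polycyclicity, the finite generation being that
of the additive group of `J / I`. -/
def PolycyclicStep (I J : Ideal B) : Prop :=
  I ≤ J ∧ (SocleMod I J ∧ (I.factor J).toAddSubgroup.FG ∨ (I.factor J : Set I.Quot).Finite)

theorem supersolubleStep_iff : SupersolubleStep I J ↔ (I : Set B) ⊆ J ∧
    ((Infinite (I.factor J).toAddSubgroup ∧ IsAddCyclic (I.factor J).toAddSubgroup ∧
      (I.factor J : Set I.Quot) ⊆ socle I.Quot) ∨ (Nat.card (I.factor J)).Prime) := by
  rw [factor_subset_socle_iff]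
  have hcard {x : B} (h : AddSubgroup.zmultiples (I.toQuot x) = (I.factor J).toAddSubgroup) :
      Nat.card (I.factor J).toAddSubgroup = addOrderOf (I.toQuot x) := by
    rw [← h, Nat.card_zmultiples]
  constructor
  · rintro ⟨x, hgen, h⟩
    obtain ⟨hIJ, hx⟩ := isGeneratedOver_iff_zmultiples_eq.mp hgen
    refine ⟨hIJ, h.imp (fun ⟨h0, hsoc⟩ => ⟨?_, ?_, hsoc⟩) fun hp => (hcard hx).symm ▸ hp⟩
    · exact (Nat.card_eq_zero.mp ((hcard hx).trans h0)).resolve_left (not_isEmpty_of_nonempty _)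
    · exact (AddSubgroup.isAddCyclic_iff_exists_zmultiples_eq_top _).mpr ⟨_, hx⟩
  · rintro ⟨hIJ, h⟩
    have hcyc : IsAddCyclic (I.factor J).toAddSubgroup :=
      h.elim (fun h => h.2.1) fun hp =>
        have := Fact.mk hp
        isAddCyclic_of_prime_card (p := Nat.card (I.factor J)) rfl
    obtain ⟨q, hq⟩ := (AddSubgroup.isAddCyclic_iff_exists_zmultiples_eq_top _).mp hcyc
    obtain ⟨x, rfl⟩ := I.quotHom_surjective q
    refine ⟨x, isGeneratedOver_iff_zmultiples_eq.mpr ⟨hIJ, hq⟩, ?_⟩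
    rw [← hcard hq]
    refine h.imp (fun ⟨hinf, _, hsoc⟩ => ⟨?_, hsoc⟩) id
    exact Nat.card_eq_zero_of_infinite

theorem fg_toAddSubgroup_of_subset_socle {S : Subbrace B} (hS : (S : Set B) ⊆ socle B)
    (hfg : S.FG) : S.toAddSubgroup.FG := by
  obtain ⟨E, hE, hmin⟩ := hfg
  have hle : AddSubgroup.closure (E : Set B) ≤ S.toAddSubgroup :=
    (AddSubgroup.closure_le _).mpr hE
  let T : Subbrace B :=
    { AddSubgroup.closure (E : Set B) with
      mul_mem' := fun ha hb => by
        rw [mul_eq_add_of_mem_socle (hS (hle ha))]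
        exact AddSubgroup.add_mem _ ha hb
      inv_mem' := fun ha => by
        rw [inv_eq_neg_of_mem_socle (hS (hle ha))]
        exact AddSubgroup.neg_mem _ ha }
  exact ⟨E, hle.antisymm (hmin T AddSubgroup.subset_closure)⟩

theorem exists_chain_iff_reflTransGen {α : Type*} {r : α → α → Prop} {a b : α} :
    (∃ (n : ℕ) (f : ℕ → α), f 0 = a ∧ f n = b ∧ ∀ i < n, r (f i) (f (i + 1))) ↔
      ReflTransGen r a b := by
  constructor
  · rintro ⟨n, f, rfl, rfl, h⟩
    induction n with
    | zero => exact .refl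
    | succ n ih => exact .tail (ih fun i hi => h i (by omega)) (h n n.lt_succ_self)
  · intro h
    induction h using ReflTransGen.head_induction_on with
    | refl => exact ⟨0, fun _ => b, rfl, rfl, by simp⟩
    | @head a c hac _ ih =>
      obtain ⟨n, f, h0, hn, hf⟩ := ih
      refine ⟨n + 1, fun i => Nat.casesOn i a f, rfl, hn, fun i hi => ?_⟩
      cases i with
      | zero => simpa [h0] using hac
      | succ i => exact hf i (by omega)

theorem isSupersoluble_iff :
    IsSupersoluble B ↔ ReflTransGen SupersolubleStep (⊥ : Ideal B) ⊤ := by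
  simp only [← exists_chain_iff_reflTransGen, IsSupersoluble, supersolubleStep_iff,
    Ideal.coe_eq_zero_iff, Ideal.coe_eq_univ_iff]

theorem IsAlmostPolycyclic.reflTransGen (h : IsAlmostPolycyclic B) :
    ReflTransGen PolycyclicStep (⊥ : Ideal B) ⊤ := by
  obtain ⟨n, J, h0, hn, hJ⟩ := h
  refine exists_chain_iff_reflTransGen.mp
    ⟨n, J, Ideal.coe_eq_zero_iff.mp h0, Ideal.coe_eq_univ_iff.mp hn, fun i hi => ?_⟩
  refine ⟨(hJ i hi).1, (hJ i hi).2.imp_left fun ⟨hsoc, hfg⟩ => ?_⟩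
  exact ⟨factor_subset_socle_iff.mp hsoc, fg_toAddSubgroup_of_subset_socle hsoc hfg⟩

end Steps

section Refinement

variable {B : Type*} [SkewBrace B] {I J : Ideal B} {x : B} {n p : ℕ}

theorem reflTransGen_of_prime_nsmul_mem (hgen : IsGeneratedOver I J x) (hp : p.Prime)
    (hx : p • x ∈ I) : ReflTransGen SupersolubleStep I J := by
  by_cases hxI : x ∈ I
  · rw [hgen.eq_of_mem hxI]
  have := Fact.mk hp
  have horder : addOrderOf (I.toQuot x) = p :=
    addOrderOf_eq_prime (I.toQuot_eq_zero_iff.mpr hx) (I.toQuot_eq_zero_iff.not.mpr hxI)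
  exact .single ⟨x, hgen, .inr (horder.symm ▸ hp)⟩

theorem reflTransGen_of_nsmul_mem (hn : n ≠ 0) (hgen : IsGeneratedOver I J x)
    (hsoc : SocleMod I J) (hx : n • x ∈ I) : ReflTransGen SupersolubleStep I J := by
  induction n using induction_on_primes generalizing J x with
  | zero => exact absurd rfl hn
  | one => rw [hgen.eq_of_mem (one_nsmul x ▸ hx)]
  | prime_mul p a hp ih =>
    obtain ⟨J', hJ'⟩ : ∃ J', IsGeneratedOver I J' (p • x) := by
      refine exists_isGeneratedOver (hsoc _ (nsmul_mem hgen.mem p)) fun b => ?_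
      exact (hgen.exists_toQuot_lam_eq_zsmul b).imp fun c hc => hc _ (nsmul_mem hgen.mem p)
    have hle : J' ≤ J := fun y hy => (hgen y).mpr <|
      AddSubgroup.zmultiples_le.mpr (AddSubgroup.nsmul_mem_zmultiples _ p) ((hJ' y).mp hy)
    have hlower : ReflTransGen SupersolubleStep I J' := by
      refine ih (right_ne_zero_of_mul hn) hJ' (fun y hy => hsoc y (hle hy)) ?_
      rwa [← mul_nsmul]
    refine hlower.trans
      (reflTransGen_of_prime_nsmul_mem (isGeneratedOver_iff.mpr fun y => ?_) hp hJ'.mem)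
    refine ⟨fun hy => (isGeneratedOver_iff.mp hgen y).mp hy |>.imp fun k hk => hJ'.le hk, ?_⟩
    rintro ⟨k, hk⟩
    simpa using add_mem (zsmul_mem hgen.mem k) (hle hk)

theorem reflTransGen_of_socleMod (hgen : IsGeneratedOver I J x) (hsoc : SocleMod I J) :
    ReflTransGen SupersolubleStep I J := by
  by_cases hx : addOrderOf (I.toQuot x) = 0
  · exact .single ⟨x, hgen, .inl ⟨hx, hsoc⟩⟩
  · exact reflTransGen_of_nsmul_mem hx hgen hsoc
      (I.toQuot_eq_zero_iff.mp (addOrderOf_nsmul_eq_zero (I.toQuot x)))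

end Refinement

section Transfer

variable {B C : Type*} [SkewBrace B] [SkewBrace C] {f : BraceHom B C}
  (hf : Function.Surjective f)

theorem toQuot_comap_eq_iff {I : Ideal C} {a b : B} :
    (f.comap I).toQuot a = (f.comap I).toQuot b ↔ I.toQuot (f a) = I.toQuot (f b) := by
  rw [Ideal.toQuot_eq_iff, Ideal.toQuot_eq_iff, BraceHom.mem_comap, map_add, map_neg]

theorem IsGeneratedOver.comap {I J : Ideal C} {x : B} (h : IsGeneratedOver I J (f x)) :
    IsGeneratedOver (f.comap I) (f.comap J) x := by
  refine isGeneratedOver_iff.mpr fun y => ?_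
  simp only [BraceHom.mem_comap, map_add, map_neg, map_zsmul, isGeneratedOver_iff.mp h]

theorem SocleMod.comap {I J : Ideal C} (h : SocleMod I J) :
    SocleMod (f.comap I) (f.comap J) := fun a ha => by
  rw [toQuot_mem_socle_iff]
  intro b
  have hab := toQuot_mem_socle_iff.mp (h (f a) ha) (f b)
  simpa only [toQuot_comap_eq_iff, map_add, f.map_lam] using hab

include hf

theorem SupersolubleStep.comap {I J : Ideal C} (h : SupersolubleStep I J) :
    SupersolubleStep (f.comap I) (f.comap J) := by
  obtain ⟨y, hgen, h⟩ := h
  obtain ⟨x, rfl⟩ := hf y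
  have horder : addOrderOf ((f.comap I).toQuot x) = addOrderOf (I.toQuot (f x)) := by
    refine addOrderOf_eq_addOrderOf_iff.mpr fun n => ?_
    change (f.comap I).toQuot (n • x) = 0 ↔ I.toQuot (n • f x) = 0
    rw [Ideal.toQuot_eq_zero_iff, Ideal.toQuot_eq_zero_iff, BraceHom.mem_comap, map_nsmul]
  exact ⟨x, hgen.comap, horder.symm ▸ h.imp_left (.imp_right SocleMod.comap)⟩

theorem toQuot_map_eq {I : Ideal B} {a b : B} (h : I.toQuot a = I.toQuot b) :
    (f.map hf I).toQuot (f a) = (f.map hf I).toQuot (f b) :=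
  (f.map hf I).toQuot_eq_iff.mpr ⟨-a + b, I.toQuot_eq_iff.mp h, by simp⟩

theorem SocleMod.map {I J : Ideal B} (h : SocleMod I J) :
    SocleMod (f.map hf I) (f.map hf J) := by
  rintro _ ⟨a, ha, rfl⟩
  refine toQuot_mem_socle_iff.mpr (hf.forall.mpr fun b => ?_)
  have hab := toQuot_mem_socle_iff.mp (h a ha) b
  simpa [f.map_lam] using And.intro (toQuot_map_eq hf hab.1) (toQuot_map_eq hf hab.2)

theorem IsGeneratedOver.map {I J : Ideal B} {x : B} (h : IsGeneratedOver I J x) :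
    IsGeneratedOver (f.map hf I) (f.map hf J) (f x) := by
  refine isGeneratedOver_iff.mpr fun y => ⟨?_, ?_⟩
  · rintro ⟨a, ha, rfl⟩
    obtain ⟨k, hk⟩ := (isGeneratedOver_iff.mp h a).mp ha
    exact ⟨k, -(k • x) + a, hk, by simp⟩
  · rintro ⟨k, a, ha, hay⟩
    exact ⟨k • x + a, add_mem (zsmul_mem h.mem k) (h.le ha), by simp_all⟩

theorem SupersolubleStep.map {I J : Ideal B} (h : SupersolubleStep I J) :
    ReflTransGen SupersolubleStep (f.map hf I) (f.map hf J) := by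
  obtain ⟨x, hgen, ⟨_, hsoc⟩ | hp⟩ := h
  · exact reflTransGen_of_socleMod (hgen.map hf) (hsoc.map hf)
  · have hx : addOrderOf (I.toQuot x) • x ∈ I :=
      I.toQuot_eq_zero_iff.mp (addOrderOf_nsmul_eq_zero (I.toQuot x))
    exact reflTransGen_of_prime_nsmul_mem (hgen.map hf) hp ⟨_, hx, by simp⟩

theorem reflTransGen_comap_top_iff {I : Ideal C} :
    ReflTransGen SupersolubleStep (f.comap I) ⊤ ↔ ReflTransGen SupersolubleStep I ⊤ := by
  refine ⟨fun h => ?_, fun h => h.lift f.comap fun _ _ => SupersolubleStep.comap hf⟩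
  have : ReflTransGen SupersolubleStep (f.map hf (f.comap I)) (f.map hf ⊤) :=
    h.lift' (f.map hf) fun _ _ => SupersolubleStep.map hf
  rwa [f.map_comap, f.map_top] at this

theorem IsSupersoluble.of_surjective (hB : IsSupersoluble B) : IsSupersoluble C := by
  have : ReflTransGen SupersolubleStep (f.map hf ⊥) (f.map hf ⊤) :=
    (isSupersoluble_iff.mp hB).lift' (f.map hf) fun _ _ => SupersolubleStep.map hf
  rwa [f.map_bot, f.map_top, ← isSupersoluble_iff] at this

theorem PolycyclicStep.map {I J : Ideal B} (h : PolycyclicStep I J) :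
    PolycyclicStep (f.map hf I) (f.map hf J) := by
  obtain ⟨hIJ, h⟩ := h
  let φ : I.Quot →+ (f.map hf I).Quot :=
    QuotientAddGroup.map _ _ (f : B →+ C) (AddSubgroup.le_comap_map _ _)
  have hφ : ((f.map hf I).factor (f.map hf J)).toAddSubgroup =
      (I.factor J).toAddSubgroup.map φ := by
    change (J.toAddSubgroup.map (f : B →+ C)).map _ = (J.toAddSubgroup.map _).map φ
    rw [AddSubgroup.map_map, AddSubgroup.map_map]
    rfl
  refine ⟨Set.image_mono hIJ, ?_⟩
  obtain ⟨hsoc, hfg⟩ | hfin := h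
  · refine .inl ⟨hsoc.map hf, ?_⟩
    rw [hφ]
    exact addSubgroup_fg_map hfg φ
  · refine .inr ?_
    have := hfin.image φ
    rwa [show φ '' (I.factor J) = _ from congrArg SetLike.coe hφ.symm] at this

theorem reflTransGen_polycyclicStep_map (h : ReflTransGen PolycyclicStep (⊥ : Ideal B) ⊤) :
    ReflTransGen PolycyclicStep (⊥ : Ideal C) ⊤ := by
  have : ReflTransGen PolycyclicStep (f.map hf ⊥) (f.map hf ⊤) :=
    h.lift (f.map hf) fun _ _ => PolycyclicStep.map hf
  rwa [f.map_bot, f.map_top] at this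

end Transfer

section InfiniteSocle

variable {B : Type*} [SkewBrace B] {I J : Ideal B}

theorem PolycyclicStep.fg_of_le (h : PolycyclicStep I J)
    (hI : ∀ H ≤ I.toAddSubgroup, H.FG) {H : AddSubgroup B} (hHJ : H ≤ J.toAddSubgroup) :
    H.FG := by
  let π := QuotientAddGroup.mk' I.toAddSubgroup
  have hle : H.map π ≤ (I.factor J).toAddSubgroup := AddSubgroup.map_mono hHJ
  refine addSubgroup_fg_of_map_fg π ?_ ?_
  · obtain ⟨-, ⟨hsoc, hfg⟩ | hfin⟩ := h
    · refine addSubgroup_fg_of_le_of_commute ?_ hfg hle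
      rintro _ ⟨a, ha, rfl⟩ b -
      exact (AddSubgroup.mem_center_iff.mp (hsoc a ha).2 b).symm
    · have : Finite (H.map π) := hfin.subset hle
      exact (AddGroup.fg_iff_addSubgroup_fg _).mp inferInstance
  · rw [QuotientAddGroup.ker_mk']
    exact hI _ inf_le_right

theorem addSubgroup_fg (h : ReflTransGen PolycyclicStep (⊥ : Ideal B) ⊤) (H : AddSubgroup B) :
    H.FG := by
  suffices ∀ J : Ideal B, ReflTransGen PolycyclicStep ⊥ J → ∀ H ≤ J.toAddSubgroup, H.FG from
    this ⊤ h H le_top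
  intro J hJ
  induction hJ with
  | refl =>
    intro H hH
    rw [show H = ⊥ from le_bot_iff.mp hH]
    exact AddSubgroup.FG.bot
  | tail _ hstep ih => exact fun H hH => hstep.fg_of_le ih hH

theorem wellFoundedGT_ideal (h : ReflTransGen PolycyclicStep (⊥ : Ideal B) ⊤) :
    WellFoundedGT (Ideal B) := by
  have := wellFoundedGT_addSubgroup_of_forall_fg (addSubgroup_fg h)
  exact StrictMono.wellFoundedGT (f := fun I : Ideal B => I.toAddSubgroup) fun _ _ h => h

theorem finite_preimage_toQuot (hI : (I : Set B).Finite) {S : Set I.Quot} (hS : S.Finite) :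
    (I.toQuot ⁻¹' S).Finite := by
  refine Set.Finite.of_finite_fibers I.toQuot (hS.subset (Set.image_preimage_subset _ _)) ?_
  rintro _ ⟨a, -, rfl⟩
  refine (hI.image (a + ·)).subset ?_
  rintro b ⟨-, hba⟩
  exact ⟨-a + b, I.toQuot_eq_iff.mp hba.symm, add_neg_cancel_left a b⟩

theorem finite_of_socleMod [AddGroup.FG B] (hsocle : (socle B).Finite) (hI : (I : Set B).Finite)
    (hsoc : SocleMod I J) : (J : Set B).Finite := by
  obtain ⟨E, hE⟩ := AddGroup.fg_def.mp ‹AddGroup.FG B›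
  let F (a : B) (e : E) : B × B := (lam a e, a + e + -a)
  refine Set.Finite.of_finite_fibers F ?_ ?_
  · have hfib (e : E) : (I.toQuot ⁻¹' {I.toQuot e}).Finite :=
      finite_preimage_toQuot hI (Set.finite_singleton _)
    refine (Set.Finite.pi' fun e => (hfib e).prod (hfib e)).subset ?_
    rintro _ ⟨a, ha, rfl⟩ e
    obtain ⟨hlam, hcomm⟩ := toQuot_mem_socle_iff.mp (hsoc a ha) e
    refine ⟨hlam, ?_⟩
    change I.toQuot (a + e) + I.toQuot (-a) = I.toQuot e
    rw [← hcomm, ← I.toQuot_add, add_neg_cancel_right]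
  · rintro _ ⟨a, -, rfl⟩
    refine (hsocle.image (a * ·)).subset ?_
    rintro b ⟨-, hba⟩
    have hlam : lamHom a = lamHom b :=
      AddMonoidHom.eq_of_eqOn_dense hE fun e he => congrArg Prod.fst (congrFun hba.symm ⟨e, he⟩)
    have hconj : (AddAut.addConj a).toAddMonoidHom = (AddAut.addConj b).toAddMonoidHom :=
      AddMonoidHom.eq_of_eqOn_dense hE fun e he => congrArg Prod.snd (congrFun hba.symm ⟨e, he⟩)
    refine ⟨a⁻¹ * b, ?_, mul_inv_cancel_left a b⟩
    exact inv_mul_mem_socle (DFunLike.congr_fun hlam) (DFunLike.congr_fun hconj)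

theorem infinite_socle [Infinite B] (h : ReflTransGen PolycyclicStep (⊥ : Ideal B) ⊤) :
    (socle B).Infinite := by
  intro hsocle
  have := AddGroup.fg_def.mpr (addSubgroup_fg h ⊤)
  suffices ∀ J : Ideal B, ReflTransGen PolycyclicStep ⊥ J → (J : Set B).Finite from
    Set.infinite_univ (this ⊤ h)
  intro J hJ
  induction hJ with
  | refl => exact Set.finite_singleton 0
  | tail _ hstep ih =>
    obtain ⟨hle, ⟨hsoc, -⟩ | hfin⟩ := hstep
    · exact finite_of_socleMod hsocle ih hsoc
    · exact (finite_preimage_toQuot ih hfin).subset fun a ha => (toQuot_mem_factor_iff hle).mpr ha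

end InfiniteSocle

section SocleRepresentation

variable {B A : Type*} [SkewBrace B] [AddCommGroup A] {ρ : Representation ℤ B A} {ι : A →+ B}

instance : AddCommGroup (socleAddSubgroup B) :=
  { (inferInstance : AddGroup (socleAddSubgroup B)) with
    add_comm := fun a b => Subtype.ext (AddSubgroup.mem_center_iff.mp b.2.2 a) }

/-- The action of a brace on its socle through `λ`. -/
def socleRep (B : Type*) [SkewBrace B] : Representation ℤ B (socleAddSubgroup B) where
  toFun b := AddMonoidHom.toIntLinearMap
    { toFun := fun a => ⟨lam b a, lam_mem_socle b a.2⟩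
      map_zero' := Subtype.ext (lam_zero b)
      map_add' := fun x y => Subtype.ext (lam_add b x y) }
  map_one' := LinearMap.ext fun a => Subtype.ext (lam_one (a : B))
  map_mul' b c := LinearMap.ext fun a => Subtype.ext (lam_mul b c a)

/-- The ideal of `B` given by a subrepresentation of a representation that maps equivariantly to
the socle. -/
def Ideal.ofSubrepresentation (hι : ∀ b a, ι (ρ b a) = lam b (ι a)) (hsoc : ∀ a, ι a ∈ socle B)
    (V : Subrepresentation ρ) : Ideal B :=
  .ofLESocle (V.toSubmodule.toAddSubgroup.map ι)
    (by
      rintro _ ⟨a, -, rfl⟩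
      exact hsoc a)
    (by
      rintro b _ ⟨a, ha, rfl⟩
      exact ⟨ρ b a, V.apply_mem_toSubmodule b ha, hι b a⟩)

/-- The preimage of an ideal, as a `ℤ`-submodule. -/
def Ideal.submoduleComap (ι : A →+ B) (I : Ideal B) : Submodule ℤ A :=
  AddSubgroup.toIntSubmodule (I.toAddSubgroup.comap ι)

theorem SupersolubleStep.isScalarStep (hι : ∀ b a, ι (ρ b a) = lam b (ι a)) {I J : Ideal B}
    (h : SupersolubleStep I J) :
    IsScalarStep ρ (I.submoduleComap ι) (J.submoduleComap ι) := by
  obtain ⟨x, hgen, -⟩ := h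
  refine ⟨fun a ha => hgen.le ha, fun b => ?_⟩
  obtain ⟨c, hc⟩ := hgen.exists_toQuot_lam_eq_zsmul b
  refine ⟨c, fun a ha => ?_⟩
  have hmem : -(c • ι a) + lam b (ι a) ∈ I := I.toQuot_eq_iff.mp (hc (ι a) ha).symm
  rwa [← hι, ← map_zsmul, ← map_neg, ← map_add, neg_add_eq_sub] at hmem

theorem submoduleComap_ofSubrepresentation (hinj : Function.Injective ι)
    (hι : ∀ b a, ι (ρ b a) = lam b (ι a)) (hsoc : ∀ a, ι a ∈ socle B) (V : Subrepresentation ρ) :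
    (Ideal.ofSubrepresentation hι hsoc V).submoduleComap ι = V.toSubmodule :=
  SetLike.coe_injective (Set.preimage_image_eq _ hinj)

theorem exists_apply_eq_smul_of_forall_ne_bot [Module.Finite ℤ A] [Module.IsTorsionFree ℤ A]
    [Nontrivial A] (hinj : Function.Injective ι) (hι : ∀ b a, ι (ρ b a) = lam b (ι a))
    (hsoc : ∀ a, ι a ∈ socle B) (hρ : IsRationallyIrreducible ρ)
    (h : ∀ I : Ideal B, I ≠ ⊥ → ReflTransGen SupersolubleStep I ⊤) (b : B) :
    ∃ c : ℤ, ∀ a, ρ b a = c • a := by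
  refine hρ.exists_apply_eq_smul (fun p hp => ?_) b
  let I := Ideal.ofSubrepresentation hι hsoc (smulTop ρ (p : ℤ))
  have hI : I ≠ ⊥ := fun hbot => by
    obtain ⟨w, hw⟩ := exists_ne (0 : A)
    have hmem : ι ((p : ℤ) • w) ∈ I := ⟨_, Submodule.smul_mem_pointwise_smul w _ ⊤ trivial, rfl⟩
    rw [hbot, Ideal.mem_bot, map_eq_zero_iff ι hinj] at hmem
    exact smul_ne_zero (Int.natCast_ne_zero.mpr hp.ne_zero) hw hmem
  have : ReflTransGen (IsScalarStep ρ) (I.submoduleComap ι) ((⊤ : Ideal B).submoduleComap ι) :=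
    (h I hI).lift (Ideal.submoduleComap ι) fun _ _ => SupersolubleStep.isScalarStep hι
  rwa [submoduleComap_ofSubrepresentation hinj] at this

theorem supersolubleStep_bot {x : B} (hx : x ∈ socle B) (horder : addOrderOf x = 0)
    (hlam : ∀ b, ∃ c : ℤ, lam b x = c • x) : ∃ J : Ideal B, J ≠ ⊥ ∧ SupersolubleStep ⊥ J := by
  have hx' : (⊥ : Ideal B).toQuot x ∈ socle (⊥ : Ideal B).Quot :=
    toQuot_mem_socle_iff.mpr fun b => by
      rw [hx.1, AddSubgroup.mem_center_iff.mp hx.2 b]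
      exact ⟨rfl, rfl⟩
  obtain ⟨J, hJ⟩ := exists_isGeneratedOver hx' fun b =>
    (hlam b).imp fun c hc => congrArg (⊥ : Ideal B).toQuot hc
  have horder' : addOrderOf ((⊥ : Ideal B).toQuot x) = 0 := by
    rw [← horder]
    exact addOrderOf_eq_addOrderOf_iff.mpr fun n => (⊥ : Ideal B).toQuot_eq_zero_iff
  refine ⟨J, fun hbot => ?_, x, hJ, .inl ⟨horder', hJ.socleMod hx'⟩⟩
  have hx0 : x = 0 := Ideal.mem_bot.mp (hbot ▸ hJ.mem)
  rw [hx0, addOrderOf_zero] at horder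
  exact one_ne_zero horder

theorem reflTransGen_bot_of_forall_ne_bot [Infinite B]
    (hB : ReflTransGen PolycyclicStep (⊥ : Ideal B) ⊤)
    (h : ∀ I : Ideal B, I ≠ ⊥ → ReflTransGen SupersolubleStep I ⊤) :
    ReflTransGen SupersolubleStep (⊥ : Ideal B) ⊤ := by
  have : Infinite (socleAddSubgroup B) := (infinite_socle hB).to_subtype
  have : Module.Finite ℤ (socleAddSubgroup B) :=
    Module.Finite.iff_addGroup_fg.mpr ((AddGroup.fg_iff_addSubgroup_fg _).mpr (addSubgroup_fg hB _))
  obtain ⟨W, _, _, hW⟩ := exists_isRationallyIrreducible (socleRep B)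
  let ι : W.toSubmodule →+ B :=
    (socleAddSubgroup B).subtype.comp W.toSubmodule.toAddSubgroup.subtype
  have hinj : Function.Injective ι := Subtype.val_injective.comp Subtype.val_injective
  have hscalar := exists_apply_eq_smul_of_forall_ne_bot hinj (fun _ _ => rfl) (fun w => w.1.2) hW h
  obtain ⟨w, hw⟩ := exists_ne (0 : W.toSubmodule)
  have := Module.isTorsionFree_int_iff_isAddTorsionFree.mp ‹Module.IsTorsionFree ℤ W.toSubmodule›
  have horder : addOrderOf (ι w) = 0 := by
    rw [addOrderOf_injective ι hinj, addOrderOf_eq_zero_iff]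
    exact not_isOfFinAddOrder_of_isAddTorsionFree hw
  obtain ⟨J, hJ, hstep⟩ := supersolubleStep_bot w.1.2 horder fun b =>
    (hscalar b).imp fun c hc => (congrArg ι (hc w)).trans (map_zsmul ι c w)
  exact .head hstep (h J hJ)

end SocleRepresentation

section Induction

variable {B : Type*} [SkewBrace B]

theorem reflTransGen_top_of_forall_finite (hB : ReflTransGen PolycyclicStep (⊥ : Ideal B) ⊤)
    (h : ∀ I : Ideal B, Finite I.Quot → ReflTransGen SupersolubleStep I ⊤) (I : Ideal B) :
    ReflTransGen SupersolubleStep I ⊤ := by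
  have := wellFoundedGT_ideal hB
  induction I using WellFoundedGT.induction with
  | ind I ih =>
  by_cases hfin : Finite I.Quot
  · exact h I hfin
  have : Infinite I.Quot := not_finite_iff_infinite.mp hfin
  have hπ := I.quotHom_surjective
  rw [← I.comap_quotHom_bot, reflTransGen_comap_top_iff hπ]
  refine reflTransGen_bot_of_forall_ne_bot (reflTransGen_polycyclicStep_map hπ hB) fun K hK => ?_
  rw [← reflTransGen_comap_top_iff hπ]
  refine ih _ ((I.le_comap_quotHom K).lt_of_ne fun hIK => hK ?_)
  rw [← I.quotHom.map_comap hπ K, ← hIK, ← I.quotHom.map_comap hπ ⊥, I.comap_quotHom_bot]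

end Induction

end SkewBrace

theorem theorem3p45 {B : Type u} [SkewBrace B] (hB : SkewBrace.IsAlmostPolycyclic B) :
    SkewBrace.IsSupersoluble B ↔
      ∀ (C : Type u) [SkewBrace C] [Finite C] (f : SkewBrace.BraceHom B C),
        Function.Surjective f.toFun → SkewBrace.IsSupersoluble C := by
  refine ⟨fun h C _ _ f hf => h.of_surjective (f := f) hf, fun h => ?_⟩
  rw [SkewBrace.isSupersoluble_iff]
  refine SkewBrace.reflTransGen_top_of_forall_finite hB.reflTransGen (fun I _ => ?_) ⊥
  have hπ := I.quotHom_surjective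
  have hquot := h I.Quot I.quotHom hπ
  rwa [SkewBrace.isSupersoluble_iff, ← SkewBrace.reflTransGen_comap_top_iff hπ,
    I.comap_quotHom_bot] at hquot
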